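/- **Setting.** Let $X=(X_n)_{n\in\mathbb Z}$ be i.i.d. random variables with values in $\{-1,0,1,2,\dots\}$, with $\mathbb P[X_0=-1]>0$ and $X_0$ integrable (the increments of a skip-free to the left random walk), and let $\pi$ be the law of $X_0+1$, with mean $m(\pi)=\mathbb E[X_0]+1$. The record map is $R(n)=\min\{j>n:\sum_{l=n}^{j-1}X_l\ge 0\}$ if such a $j$ exists, and $R(n)=n$ otherwise. The record graph is the graph on $\mathbb Z$ with directed edges $(n,R(n))$ for $R(n)\ne n$. A *Family Tree* is a locally finite directed tree in which every vertex has at most one outgoing edge, which leads to its *parent*; it is *ordered* if the children of every vertex are totally ordered. Rooted ordered Family Trees are considered up to root- and order-preserving isomorphism, and the space of isomorphism classes carries the local topology (generated by the balls around the root) and its Borel $\sigma$-algebra; the same for doubly rooted trees. Let $[\mathbf T,0]$ be the connected component of $0$ in the record graph, rooted at $0$, the children of each vertex being ordered as integers. For an offspring distribution $\pi$ on $\{0,1,2,\dots\}$ with mean $m(\pi)<1$, the *Typically rooted Galton–Watson Tree* $TGWT(\pi)$ is the law of the following random rooted ordered Family Tree. The root has $k$ ancestors with probability $(1-m(\pi))\,m(\pi)^k$,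 $k\ge 0$. Independently for each ancestor, let $Z$ have the size-biased law $\hat\pi(n)=n\pi(n)/m(\pi)$; the ancestor has $Z$ children, namely the vertex that is already present (the root or the preceding ancestor) and $Z-1$ new ones, and the position of the vertex already present among the $Z$ children is uniform. To the root and to each of the new children, independent ordered Galton–Watson trees with offspring distribution $\pi$ are attached. (If $m(\pi)=0$, the tree consists of the root only.) **Theorem.** If $\mathbb E[X_0]<0$, then $m(\pi)<1$ and the law of $[\mathbf T,0]$ is $TGWT(\pi)$. In particular: - $[\mathbf T,0]$ is unimodular, that is, $\mathbb E\big[\sum_{u\in V(\mathbf T)}f([\mathbf T,0,u])\big]=\mathbb E\big[\sum_{u\in V(\mathbf T)}f([\mathbf T,u,0])\big]$ for every measurable $f\ge 0$ on the space of doubly rooted ordered Family Trees; - almost surely, $\mathbf T$ is finite and of class $\mathcal F/\mathcal F$: $\mathbf T$ is finite, and so are all its foils, the foil of $u$ being the set of vertices $v$ with $F^n(u)=F^n(v)$ for some $n\ge 0$, where $F$ maps a vertex to its parent if it has one and to itself otherwise. -/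

import Mathlib

open MeasureTheory ProbabilityTheory
open scoped ENNReal

/-! ### Ordered Family Trees -/

/-- The parent vertex-shift: a vertex is sent to its parent if it has one, and to itself
otherwise. -/
def parentShift {V : Type} (parent : V → Option V) (u : V) : V := (parent u).getD u

/-- An ordered Family Tree with vertex set `V`: a locally finite directed tree in which every
vertex has at most one outgoing edge (to its parent), together with a strict total order on the
set of children of every vertex.

A directed graph of out-degree at most one is connected iff any two vertices have a common
(weak) ancestor, and it is then a tree iff no vertex having a parent is its own `n`-th ancestor
for some `n > 0`. -/
structure OrderedFamilyTree (V : Type) where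
  parent : V → Option V
  connected : ∀ u v, ∃ m n : ℕ, (parentShift parent)^[m] u = (parentShift parent)^[n] v
  acyclic : ∀ u (n : ℕ), 0 < n → (parentShift parent)^[n] u = u → parent u = none
  finite_children : ∀ v, {u | parent u = some v}.Finite
  /-- The order among siblings. -/
  lt : V → V → Prop
  lt_siblings : ∀ u v, lt u v → ∃ p, parent u = some p ∧ parent v = some p
  lt_irrefl : ∀ u, ¬ lt u u
  lt_trans : ∀ u v w, lt u v → lt v w → lt u w
  lt_trichotomous : ∀ u v p, parent u = some p → parent v = some p → lt u v ∨ u = v ∨ lt v u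

namespace OrderedFamilyTree

variable {V : Type}

/-- The parent vertex-shift of a Family Tree. -/
def shift (T : OrderedFamilyTree V) : V → V := parentShift T.parent

/-- The underlying undirected graph. -/
def graph (T : OrderedFamilyTree V) : SimpleGraph V :=
  SimpleGraph.fromRel fun u v => T.parent u = some v

/-- The foil of `u`: all vertices `v` having the same `n`-th image as `u` under the parent
vertex-shift, for some `n`. -/
def foil (T : OrderedFamilyTree V) (u : V) : Set V :=
  {v | ∃ n : ℕ, T.shift^[n] v = T.shift^[n] u}

/-- Class `F/F`: the tree and all its foils are finite. -/
def IsClassFF (T : OrderedFamilyTree V) : Prop :=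
  Finite V ∧ ∀ u, (T.foil u).Finite

end OrderedFamilyTree

/-! ### The spaces of rooted and doubly rooted ordered Family Trees -/

/-- An ordered Family Tree with `k` distinguished vertices, called roots. -/
structure RootedFamilyTree (k : ℕ) where
  V : Type
  tree : OrderedFamilyTree V
  root : Fin k → V

namespace RootedFamilyTree

variable {k : ℕ}

/-- Isomorphism of trees preserving edges, their direction, the order among siblings and the
roots. -/
def Iso (T S : RootedFamilyTree k) : Prop :=
  ∃ e : T.V ≃ S.V,
    (∀ i, e (T.root i) = S.root i) ∧
    (∀ u v, T.tree.parent u = some v ↔ S.tree.parent (e u) = some (e v)) ∧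
    (∀ u v, T.tree.lt u v ↔ S.tree.lt (e u) (e v))

theorem Iso.refl (T : RootedFamilyTree k) : T.Iso T :=
  ⟨Equiv.refl _, fun _ => rfl, fun _ _ => Iff.rfl, fun _ _ => Iff.rfl⟩

theorem Iso.symm {T S : RootedFamilyTree k} (h : T.Iso S) : S.Iso T := by
  obtain ⟨e, h1, h2, h3⟩ := h
  refine ⟨e.symm, fun i => by rw [← h1 i, e.symm_apply_apply], fun u v => ?_, fun u v => ?_⟩
  · rw [h2, e.apply_symm_apply, e.apply_symm_apply]
  · rw [h3, e.apply_symm_apply, e.apply_symm_apply]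

theorem Iso.trans {T S U : RootedFamilyTree k} (h : T.Iso S) (g : S.Iso U) : T.Iso U := by
  obtain ⟨e, h1, h2, h3⟩ := h
  obtain ⟨d, g1, g2, g3⟩ := g
  refine ⟨e.trans d, fun i => ?_, fun u v => ?_, fun u v => ?_⟩
  · simp [h1, g1]
  · rw [h2, g2]; rfl
  · rw [h3, g3]; rfl

instance setoid (k : ℕ) : Setoid (RootedFamilyTree k) where
  r := Iso
  iseqv := ⟨Iso.refl, Iso.symm, Iso.trans⟩

/-- The vertices at graph distance at most `r` from at least one of the roots. -/
def ball (T : RootedFamilyTree k) (r : ℕ) : Set T.V :=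
  {v | ∃ i, T.tree.graph.dist (T.root i) v ≤ r}

/-- The ordered directed subgraphs induced by the balls of radius `r` around the roots are
isomorphic, by an isomorphism that preserves the roots. -/
def BallIso (T S : RootedFamilyTree k) (r : ℕ) : Prop :=
  ∃ e : T.ball r ≃ S.ball r,
    (∀ i, ∀ u : T.ball r, (u : T.V) = T.root i ↔ (e u : S.V) = S.root i) ∧
    (∀ u v : T.ball r, T.tree.parent u = some (v : T.V) ↔ S.tree.parent (e u) = some (e v : S.V)) ∧
    (∀ u v : T.ball r, T.tree.lt u v ↔ S.tree.lt (e u) (e v))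

end RootedFamilyTree

/-- The space of isomorphism classes of ordered Family Trees with `k` roots. The space of rooted
Family Trees is `FamilyTreeSpace 1`, that of doubly rooted ones is `FamilyTreeSpace 2`. -/
def FamilyTreeSpace (k : ℕ) : Type 1 := Quotient (RootedFamilyTree.setoid k)

namespace FamilyTreeSpace

variable {k : ℕ}

/-- The isomorphism class of a tree with roots. -/
def mk (T : RootedFamilyTree k) : FamilyTreeSpace k := Quotient.mk _ T

/-- All classes that have the same ball of radius `r` around the roots as `T`. -/
def cylinder (T : RootedFamilyTree k) (r : ℕ) : Set (FamilyTreeSpace k) :=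
  {x | ∃ S : RootedFamilyTree k, mk S = x ∧ T.BallIso S r}

/-- The local topology. -/
instance : TopologicalSpace (FamilyTreeSpace k) :=
  TopologicalSpace.generateFrom {U | ∃ T r, U = cylinder T r}

instance : MeasurableSpace (FamilyTreeSpace k) := borel _

instance : BorelSpace (FamilyTreeSpace k) := ⟨rfl⟩

/-- `[T, o] ↦ ∑_{u ∈ V(T)} f [T, o, u]`. -/
noncomputable def massOut (f : FamilyTreeSpace 2 → ℝ≥0∞) : FamilyTreeSpace 1 → ℝ≥0∞ :=
  Quotient.lift (fun T => ∑' u : T.V, f (mk ⟨T.V, T.tree, ![T.root 0, u]⟩)) (by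
    rintro T S ⟨e, h1, h2, h3⟩
    rw [← e.tsum_eq]
    refine tsum_congr fun u => congrArg f (Quotient.sound ⟨e, fun i => ?_, h2, h3⟩)
    fin_cases i
    · exact h1 0
    · rfl)

/-- `[T, o] ↦ ∑_{u ∈ V(T)} f [T, u, o]`. -/
noncomputable def massIn (f : FamilyTreeSpace 2 → ℝ≥0∞) : FamilyTreeSpace 1 → ℝ≥0∞ :=
  Quotient.lift (fun T => ∑' u : T.V, f (mk ⟨T.V, T.tree, ![u, T.root 0]⟩)) (by
    rintro T S ⟨e, h1, h2, h3⟩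
    rw [← e.tsum_eq]
    refine tsum_congr fun u => congrArg f (Quotient.sound ⟨e, fun i => ?_, h2, h3⟩)
    fin_cases i
    · rfl
    · exact h1 0)

/-- A law on rooted Family Trees is unimodular if it satisfies the Mass Transport Principle. -/
def IsUnimodular (μ : Measure (FamilyTreeSpace 1)) : Prop :=
  ∀ f : FamilyTreeSpace 2 → ℝ≥0∞, Measurable f → ∫⁻ x, massOut f x ∂μ = ∫⁻ x, massIn f x ∂μ

end FamilyTreeSpace

/-! ### A criterion for acyclicity -/

theorem parentShift_iterate_le {V : Type} {parent : V → Option V} (g : V → ℤ)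
    (hg : ∀ u v, parent u = some v → g u < g v) (n : ℕ) (u : V) :
    g u ≤ g ((parentShift parent)^[n] u) := by
  induction n generalizing u with
  | zero => exact le_rfl
  | succ n ih =>
    rw [Function.iterate_succ_apply]
    refine le_trans ?_ (ih _)
    unfold parentShift
    cases h : parent u with
    | none => simp
    | some v => simpa using (hg u v h).le

theorem parentShift_acyclic {V : Type} {parent : V → Option V} (g : V → ℤ)
    (hg : ∀ u v, parent u = some v → g u < g v) (u : V) (n : ℕ) (hn : 0 < n)
    (h : (parentShift parent)^[n] u = u) : parent u = none := by
  cases hp : parent u with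
  | none => rfl
  | some v =>
    obtain ⟨n, rfl⟩ := Nat.exists_eq_succ_of_ne_zero hn.ne'
    rw [Nat.succ_eq_add_one, Function.iterate_succ_apply] at h
    have h1 : parentShift parent u = v := by simp [parentShift, hp]
    rw [h1] at h
    have h2 := parentShift_iterate_le g hg n v
    rw [h] at h2
    exact absurd (hg u v hp) (not_lt.mpr h2)

/-! ### The record graph of an integer sequence -/

/-- `y(n, j) = x_n + ⋯ + x_{j-1}`. -/
noncomputable def partialSum (x : ℤ → ℤ) (n j : ℤ) : ℤ := ∑ l ∈ Finset.Ico n j, x l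

open Classical in
/-- The record map: `R_x(n) = inf {j > n : y(n, j) ≥ 0}` if such a `j` exists, else `n`. -/
noncomputable def recordMap (x : ℤ → ℤ) (n : ℤ) : ℤ :=
  if {j : ℤ | n < j ∧ 0 ≤ partialSum x n j}.Nonempty then
    sInf {j : ℤ | n < j ∧ 0 ≤ partialSum x n j} else n

/-- The connected component of `0` in the record graph, the graph on `ℤ` with the directed edges
`(n, R_x(n))` for `R_x(n) ≠ n`. -/
abbrev RecordComponent (x : ℤ → ℤ) : Type :=
  {v : ℤ // ∃ m n : ℕ, (recordMap x)^[m] v = (recordMap x)^[n] 0}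

theorem recordMap_spec {x : ℤ → ℤ} {n : ℤ} (h : recordMap x n ≠ n) :
    n < recordMap x n ∧ 0 ≤ partialSum x n (recordMap x n) ∧
      ∀ j, n < j → j < recordMap x n → partialSum x n j < 0 := by
  unfold recordMap at h ⊢
  split_ifs at h ⊢ with hne
  · have hb : BddBelow {j : ℤ | n < j ∧ 0 ≤ partialSum x n j} := ⟨n, fun j hj => hj.1.le⟩
    have hm := Int.csInf_mem hne hb
    refine ⟨hm.1, hm.2, fun j hj hlt => ?_⟩
    by_contra hc
    exact absurd (csInf_le hb ⟨hj, not_lt.mp hc⟩) (not_le.mpr hlt)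
  · exact absurd rfl h

theorem partialSum_add (x : ℤ → ℤ) {a b c : ℤ} (hab : a ≤ b) (hbc : b ≤ c) :
    partialSum x a b + partialSum x b c = partialSum x a c := by
  unfold partialSum
  rw [← Finset.sum_union (Finset.Ico_disjoint_Ico_consecutive a b c),
    Finset.Ico_union_Ico_eq_Ico hab hbc]

theorem recordMap_fiber_finite (x : ℤ → ℤ) (i : ℤ) :
    {u : ℤ | recordMap x u = i ∧ recordMap x u ≠ u}.Finite := by
  have hlt : ∀ u v, u ∈ {u : ℤ | recordMap x u = i ∧ recordMap x u ≠ u} →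
      v ∈ {u : ℤ | recordMap x u = i ∧ recordMap x u ≠ u} → u < v →
      partialSum x u i < partialSum x v i := by
    rintro u v ⟨hu, hu'⟩ ⟨hv, hv'⟩ huv
    have h1 := recordMap_spec hu'
    have h2 := recordMap_spec hv'
    rw [hu] at h1
    rw [hv] at h2
    have h3 := h1.2.2 v huv h2.1
    have h4 := partialSum_add x huv.le h2.1.le
    omega
  refine Set.Finite.of_finite_image (f := fun u => partialSum x u i)
    ((Set.finite_Icc (0 : ℤ) (x (i - 1))).subset ?_) ?_
  · rintro _ ⟨u, ⟨hu, hu'⟩, rfl⟩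
    have h1 := recordMap_spec hu'
    rw [hu] at h1
    refine ⟨h1.2.1, ?_⟩
    have h5 : partialSum x (i - 1) i = x (i - 1) := by
      have : Finset.Ico (i - 1) i = {i - 1} := by
        ext j
        simp only [Finset.mem_Ico, Finset.mem_singleton]
        omega
      rw [partialSum, this, Finset.sum_singleton]
    rcases (show u ≤ i - 1 by omega).eq_or_lt with h | h
    · simp only [h, h5, le_refl]
    · have h3 := h1.2.2 (i - 1) h (by omega)
      have h4 := partialSum_add x h.le (show i - 1 ≤ i by omega)
      simp only
      omega
  · intro u hu v hv huv
    rcases lt_trichotomy u v with h | h | h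
    · exact absurd huv (hlt u v hu hv h).ne
    · exact h
    · exact absurd huv (hlt v u hv hu h).ne'

namespace RecordComponent

variable (x : ℤ → ℤ)

/-- The record map restricted to the component of `0`. -/
noncomputable def next (u : RecordComponent x) : RecordComponent x :=
  ⟨recordMap x u.1, by
    obtain ⟨m, n, h⟩ := u.2
    refine ⟨m, n + 1, ?_⟩
    rw [← Function.iterate_succ_apply (recordMap x), Function.iterate_succ_apply', h,
      ← Function.iterate_succ_apply' (recordMap x)]⟩

open Classical in
/-- The parent of an integer is its record, loops being discarded. -/
noncomputable def parent (u : RecordComponent x) : Option (RecordComponent x) :=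
  if recordMap x u.1 = u.1 then none else some (next x u)

theorem parentShift_parent (u : RecordComponent x) : parentShift (parent x) u = next x u := by
  unfold parentShift parent
  split_ifs with h
  · exact Subtype.ext h.symm
  · rfl

theorem iterate_val (n : ℕ) (u : RecordComponent x) :
    ((parentShift (parent x))^[n] u).1 = (recordMap x)^[n] u.1 := by
  induction n generalizing u with
  | zero => rfl
  | succ n ih =>
    rw [Function.iterate_succ_apply, Function.iterate_succ_apply, ih, parentShift_parent]
    rfl

theorem parent_eq_some {u v : RecordComponent x} (h : parent x u = some v) :
    recordMap x u.1 = v.1 ∧ recordMap x u.1 ≠ u.1 := by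
  unfold parent at h
  split_ifs at h with h1
  exact ⟨congrArg Subtype.val (Option.some.inj h), h1⟩

/-- The component of `0` in the record graph as an ordered Family Tree; the children of every
vertex are ordered as integers. -/
noncomputable def tree : OrderedFamilyTree (RecordComponent x) where
  parent := parent x
  connected u v := by
    obtain ⟨a, b, hu⟩ := u.2
    obtain ⟨c, d, hv⟩ := v.2
    refine ⟨d + a, b + c, Subtype.ext ?_⟩
    rw [iterate_val, iterate_val, Function.iterate_add_apply, Function.iterate_add_apply, hu, hv,
      ← Function.iterate_add_apply, ← Function.iterate_add_apply, add_comm]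
  acyclic := parentShift_acyclic Subtype.val (fun u v h => by
    obtain ⟨h1, h2⟩ := parent_eq_some x h
    rw [← h1]
    exact (recordMap_spec h2).1)
  finite_children v := by
    refine Set.Finite.of_finite_image (f := Subtype.val)
      ((recordMap_fiber_finite x v.1).subset ?_) Subtype.val_injective.injOn
    rintro _ ⟨u, hu, rfl⟩
    exact parent_eq_some x hu
  lt u v := (∃ p, parent x u = some p ∧ parent x v = some p) ∧ u.1 < v.1
  lt_siblings _ _ h := h.1
  lt_irrefl _ h := lt_irrefl _ h.2
  lt_trans := by
    rintro u v w ⟨⟨p, hu, hv⟩, huv⟩ ⟨⟨q, hv', hw⟩, hvw⟩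
    exact ⟨⟨p, hu, by rw [hw, ← hv', hv]⟩, huv.trans hvw⟩
  lt_trichotomous := by
    intro u v p hu hv
    rcases lt_trichotomy u.1 v.1 with h | h | h
    · exact Or.inl ⟨⟨p, hu, hv⟩, h⟩
    · exact Or.inr (Or.inl (Subtype.ext h))
    · exact Or.inr (Or.inr ⟨⟨p, hv, hu⟩, h⟩)

/-- The component of `0` in the record graph, rooted at `0`. -/
noncomputable def rooted : RootedFamilyTree 1 := ⟨RecordComponent x, tree x, fun _ => ⟨0, 0, 0, rfl⟩⟩

end RecordComponent

/-! ### Skip-free increments -/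

/-- `X = (X_n)_{n ∈ ℤ}` are i.i.d. increments of a skip-free to the left random walk. -/
structure IsSkipFreeIncrements {Ω : Type*} [MeasurableSpace Ω] (X : ℤ → Ω → ℤ) (P : Measure Ω) :
    Prop where
  measurable : ∀ n, Measurable (X n)
  indep : iIndepFun X P
  identDistrib : ∀ n, IdentDistrib (X n) (X 0) P P
  ge_neg_one : ∀ n, ∀ᵐ ω ∂P, -1 ≤ X n ω
  neg_one_pos : 0 < P {ω | X 0 ω = -1}
  integrable : Integrable (fun ω => (X 0 ω : ℝ)) P

/-! ### The Typically rooted Galton–Watson Tree -/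

namespace TGWT

/-- The mean `m(π)` of an offspring distribution. -/
noncomputable def mean (π : PMF ℕ) : ℝ≥0∞ := ∑' n : ℕ, (n : ℝ≥0∞) * π n

open Classical in
/-- The size-biased distribution `n ↦ n π(n) / m(π)`. If `m(π)` is zero or infinite there is no
such distribution and the value is a convention; in the tree below it is used only if the root
has a parent, which has probability zero when `m(π) = 0`. -/
noncomputable def sizeBiased (π : PMF ℕ) : PMF ℕ :=
  if h : mean π ≠ 0 ∧ mean π ≠ ∞ then PMF.normalize (fun n : ℕ => (n : ℝ≥0∞) * π n) h.1 h.2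
  else PMF.pure 1

/-- The law of the number of ancestors of the root, `k ↦ (1 - m) m ^ k`. -/
noncomputable def ancestorLaw (m : ℝ≥0∞) (hm : m < 1) : PMF ℕ :=
  ⟨fun k => (1 - m) * m ^ k, by
    have h : ∑' k : ℕ, (1 - m) * m ^ k = 1 := by
      rw [ENNReal.tsum_mul_left, ENNReal.tsum_geometric]
      exact ENNReal.mul_inv_cancel (tsub_pos_of_lt hm).ne' (by finiteness)
    have h' := (ENNReal.summable (f := fun k : ℕ => (1 - m) * m ^ k)).hasSum
    rwa [h] at h'⟩

/-- The law of `(Z - 1, U)`, where `Z` is size-biased and, given `Z`, `U` is uniform on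
`{0, …, Z - 1}`: the number of new children attached to an ancestor, and the position, among all
`Z` children of this ancestor, of the child that is the root or an ancestor of the root. -/
noncomputable def spineLaw (π : PMF ℕ) : PMF (ℕ × ℕ) :=
  ((sizeBiased π).map fun z => z - 1).bind fun s =>
    (PMF.uniformOfFinset (Finset.range (s + 1)) Finset.nonempty_range_add_one).map fun u => (s, u)

section Tree

/- `N` is the number of ancestors of the root, `spine i = (Z - 1, U)` is the datum of the
`(i + 1)`-st ancestor, and `ξ` gives the offspring numbers of the vertices that are not
ancestors of the root.

Vertices are coded by pairs: `(i, [])` is the `i`-th ancestor of the root (the root itself for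
`i = 0`), and `(i, j :: w)` is the child in position `j` of `(i, w)`. -/
variable (N : ℕ) (spine : ℕ → ℕ × ℕ) (ξ : ℕ × List ℕ → ℕ)

/-- The positions available for the children of `(i, w)` that are not ancestors of the root nor
the root. -/
def IsPosition : ℕ → List ℕ → ℕ → Prop
  | i + 1, [], j => j < (spine i).1 + 1 ∧ j ≠ (spine i).2
  | 0, [], j => j < ξ (0, [])
  | i, a :: w, j => j < ξ (i, a :: w)

/-- The codes that are vertices of the tree. -/
def IsVertex : ℕ → List ℕ → Prop
  | i, [] => i ≤ N
  | i, j :: w => IsVertex i w ∧ IsPosition spine ξ i w j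

/-- The vertex set. -/
abbrev Vertex : Type := {v : ℕ × List ℕ // IsVertex N spine ξ v.1 v.2}

/-- The parent of a vertex. -/
def parent : Vertex N spine ξ → Option (Vertex N spine ξ)
  | ⟨(i, []), _⟩ => if h : i + 1 ≤ N then some ⟨(i + 1, []), h⟩ else none
  | ⟨(i, _ :: w), h⟩ => some ⟨(i, w), h.1⟩

/-- The position of a vertex among its siblings. -/
def position : Vertex N spine ξ → ℕ
  | ⟨(i, []), _⟩ => (spine i).2
  | ⟨(_, j :: _), _⟩ => j

theorem parent_lt {u v : Vertex N spine ξ} (h : parent N spine ξ u = some v) :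
    (u.1.1 : ℤ) - u.1.2.length < (v.1.1 : ℤ) - v.1.2.length := by
  obtain ⟨⟨i, w⟩, hu⟩ := u
  cases w with
  | nil =>
    simp only [parent] at h
    split_ifs at h with h1
    cases h
    simp
  | cons j w =>
    cases h
    simp only [List.length_cons]
    push_cast
    omega

theorem exists_iterate_eq (v : Vertex N spine ξ) :
    ∃ n : ℕ, (parentShift (parent N spine ξ))^[n] v = ⟨(N, []), le_refl N⟩ := by
  obtain ⟨⟨i, w⟩, hv⟩ := v
  induction w with
  | nil =>
    obtain ⟨d, hd⟩ := Nat.exists_eq_add_of_le (show i ≤ N from hv)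
    induction d generalizing i with
    | zero => exact ⟨0, Subtype.ext (Prod.ext hd.symm rfl)⟩
    | succ d ih =>
      have h1 : i + 1 ≤ N := by omega
      obtain ⟨n, hn⟩ := ih (i + 1) h1 (by omega)
      refine ⟨n + 1, ?_⟩
      have h2 : parentShift (parent N spine ξ) ⟨(i, []), hv⟩ = ⟨(i + 1, []), h1⟩ := by
        simp [parentShift, parent, h1]
      exact (congrArg (parentShift (parent N spine ξ))^[n] h2).trans hn
  | cons j w ih =>
    obtain ⟨n, hn⟩ := ih hv.1
    exact ⟨n + 1, hn⟩

theorem isPosition_finite (i : ℕ) (w : List ℕ) : {j | IsPosition spine ξ i w j}.Finite := by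
  cases w with
  | nil =>
    cases i with
    | zero => exact Set.finite_Iio (ξ (0, []))
    | succ i => exact (Set.finite_Iio ((spine i).1 + 1)).subset fun j hj => hj.1
  | cons a w => cases i <;> exact Set.finite_Iio (ξ (_, a :: w))

theorem eq_of_position_eq {u v p : Vertex N spine ξ} (hu : parent N spine ξ u = some p)
    (hv : parent N spine ξ v = some p)
    (h : position N spine ξ u = position N spine ξ v) : u = v := by
  obtain ⟨⟨i, w⟩, hu'⟩ := u
  obtain ⟨⟨k, z⟩, hv'⟩ := v
  cases w with
  | nil =>
    simp only [parent] at hu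
    split_ifs at hu with h1
    cases hu
    cases z with
    | nil =>
      simp only [parent] at hv
      split_ifs at hv with h2
      cases hv
      rfl
    | cons a z =>
      cases hv
      exact absurd h.symm hv'.2.2
  | cons j w =>
    cases hu
    cases z with
    | nil =>
      simp only [parent] at hv
      split_ifs at hv with h2
      cases hv
      exact absurd h hu'.2.2
    | cons a z =>
      cases hv
      cases h
      rfl

/-- The ordered Family Tree built from the data. -/
def tree : OrderedFamilyTree (Vertex N spine ξ) where
  parent := parent N spine ξ
  connected u v := by
    obtain ⟨m, hm⟩ := exists_iterate_eq N spine ξ u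
    obtain ⟨n, hn⟩ := exists_iterate_eq N spine ξ v
    exact ⟨m, n, hm.trans hn.symm⟩
  acyclic := parentShift_acyclic (fun v => (v.1.1 : ℤ) - v.1.2.length)
    fun _ _ h => parent_lt N spine ξ h
  finite_children p := by
    refine Set.Finite.of_finite_image (f := position N spine ξ)
      (((isPosition_finite spine ξ p.1.1 p.1.2).union
        (Set.finite_singleton (spine (p.1.1 - 1)).2)).subset ?_)
      fun u hu v hv h => eq_of_position_eq N spine ξ hu hv h
    rintro _ ⟨⟨⟨i, w⟩, hv⟩, h, rfl⟩
    change parent N spine ξ _ = some p at h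
    cases w with
    | nil =>
      simp only [parent] at h
      split_ifs at h with h1
      cases h
      exact Or.inr rfl
    | cons j w =>
      cases h
      exact Or.inl hv.2
  lt u v := (∃ p, parent N spine ξ u = some p ∧ parent N spine ξ v = some p) ∧
    position N spine ξ u < position N spine ξ v
  lt_siblings _ _ h := h.1
  lt_irrefl _ h := lt_irrefl _ h.2
  lt_trans := by
    rintro u v w ⟨⟨p, hu, hv⟩, huv⟩ ⟨⟨q, hv', hw⟩, hvw⟩
    exact ⟨⟨p, hu, by rw [hw, ← hv', hv]⟩, huv.trans hvw⟩
  lt_trichotomous := by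
    intro u v p hu hv
    rcases lt_trichotomy (position N spine ξ u) (position N spine ξ v) with h | h | h
    · exact Or.inl ⟨⟨p, hu, hv⟩, h⟩
    · exact Or.inr (Or.inl (eq_of_position_eq N spine ξ hu hv h))
    · exact Or.inr (Or.inr ⟨⟨p, hv, hu⟩, h⟩)

/-- The tree built from the data, with its root. -/
def rooted : RootedFamilyTree 1 :=
  ⟨Vertex N spine ξ, tree N spine ξ, fun _ => ⟨(0, []), Nat.zero_le N⟩⟩

end Tree

/-- The law of the Typically rooted Galton–Watson Tree with offspring distribution `π` of mean
less than one: the number of ancestors of the root, the data of the ancestors and the offspring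
numbers of all other vertices are independent, with laws `ancestorLaw`, `spineLaw π` and `π`. -/
noncomputable def law (π : PMF ℕ) (hπ : mean π < 1) : Measure (FamilyTreeSpace 1) :=
  ((ancestorLaw (mean π) hπ).toMeasure.prod
    ((Measure.infinitePi fun _ : ℕ => (spineLaw π).toMeasure).prod
      (Measure.infinitePi fun _ : ℕ × List ℕ => π.toMeasure))).map
    fun d => FamilyTreeSpace.mk (rooted d.1 d.2.1 d.2.2)

end TGWT

/-! Write y(u,v) for `partialSum x u v`. By the strong law of large numbers, y is almost surely
eventually negative in both directions, so the component of 0 is finite. Everything else about its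
shape is deterministic. Since y(u,i) drops by at most one when u moves one step to the left, the
children of i are in increasing bijection, via u ↦ y(u,i), with {0, …, x_{i-1}}. Hence i has
x_{i-1}+1 children and y gives their positions. Edges do not cross, so the component is an interval
of integers whose order is the depth-first order of the tree.

An isomorphism of rooted components is therefore an increasing bijection of intervals fixing 0, i.e.
the identity (`recordGraph_eq_of_iso`). So both the sequence space and the data space of the
Galton–Watson construction split into countably many pieces indexed by the possible finite record
graphs, and it remains to compare the masses of the pieces.

A given component C with top b forces x_{v-1} for every v in C, and that b has no parent. The first
event involves indices below b, the second indices from b on, and a vertex has no parent with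
probability 1-m by mass transport between parents and children. So the piece has mass at most (1-m)
∏ π(x_{v-1}+1). On the data side, size-biasing and the uniform position cancel: m · `spineLaw` (s,u)
≥ π(s+1). Thus the factor m^height absorbs the spine, and the corresponding cylinder has at least
that mass. As the first family of masses sums to 1 and the second, by disjointness, to at most 1,
all the inequalities are equalities (`map_eq_map_of_measure_le`); no exact mass has to be computed.

Unimodularity comes from translation invariance: shifting by u turns the roots (0,u) into (-u,0).
Measurability causes no trouble because finite trees are isolated points, so the law is carried by
countably many Borel atoms. -/

/-! ### The record map of a sequence drifting to `-∞` -/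

/-- An integer sequence with skip-free to the left partial sums that are eventually negative, in
both directions. -/
structure DriftsDown (x : ℤ → ℤ) : Prop where
  ge_neg_one : ∀ n, -1 ≤ x n
  forward : ∀ n, ∃ J, ∀ j, J ≤ j → partialSum x n j < 0
  backward : ∀ n, ∃ L, ∀ v, v ≤ L → partialSum x v n < 0

section RecordMap

variable {x : ℤ → ℤ}

theorem partialSum_self (n : ℤ) : partialSum x n n = 0 := by simp [partialSum]

theorem partialSum_pred (i : ℤ) : partialSum x (i - 1) i = x (i - 1) := by
  have : Finset.Ico (i - 1) i = {i - 1} := by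
    ext j
    simp only [Finset.mem_Ico, Finset.mem_singleton]
    omega
  rw [partialSum, this, Finset.sum_singleton]

theorem partialSum_succ_left {u i : ℤ} (h : u < i) :
    partialSum x u i = x u + partialSum x (u + 1) i := by
  rw [← partialSum_add x (show u ≤ u + 1 by omega) (show u + 1 ≤ i by omega)]
  have := partialSum_pred (x := x) (u + 1)
  simp only [add_sub_cancel_right] at this
  rw [this]

theorem recordMap_of_nonneg {u j : ℤ} (h : u < j) (hy : 0 ≤ partialSum x u j) :
    u < recordMap x u ∧ recordMap x u ≤ j := by
  have hne : {j : ℤ | u < j ∧ 0 ≤ partialSum x u j}.Nonempty := ⟨j, h, hy⟩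
  have hb : BddBelow {j : ℤ | u < j ∧ 0 ≤ partialSum x u j} := ⟨u, fun j hj => hj.1.le⟩
  rw [recordMap, if_pos hne]
  exact ⟨(Int.csInf_mem hne hb).1, csInf_le hb ⟨h, hy⟩⟩

theorem le_recordMap (u : ℤ) : u ≤ recordMap x u := by
  by_cases h : recordMap x u = u
  · exact h.ge
  · exact (recordMap_spec h).1.le

theorem recordMap_eq {u i : ℤ} (h : u < i) (hy : 0 ≤ partialSum x u i)
    (hj : ∀ j, u < j → j < i → partialSum x u j < 0) : recordMap x u = i := by
  obtain ⟨h1, h2⟩ := recordMap_of_nonneg h hy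
  refine h2.antisymm (not_lt.mp fun h3 => ?_)
  have := (recordMap_spec h1.ne').2.1
  have := hj _ h1 h3
  omega

theorem recordMap_eq_self_iff {u : ℤ} :
    recordMap x u = u ↔ ∀ j, u < j → partialSum x u j < 0 := by
  constructor
  · intro h j hj
    by_contra hc
    exact (recordMap_of_nonneg hj (not_lt.mp hc)).1.ne' h
  · intro h
    by_contra hc
    have h1 := recordMap_spec hc
    exact absurd (h _ h1.1) (not_lt.mpr h1.2.1)

theorem partialSum_recordMap_nonneg (u : ℤ) : 0 ≤ partialSum x u (recordMap x u) := by
  by_cases h : recordMap x u = u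
  · rw [h, partialSum_self]
  · exact (recordMap_spec h).2.1

theorem le_iterate_recordMap (n : ℕ) (u : ℤ) : u ≤ (recordMap x)^[n] u := by
  induction n generalizing u with
  | zero => exact le_rfl
  | succ n ih =>
    rw [Function.iterate_succ_apply]
    exact (le_recordMap u).trans (ih _)

/-- Each jump to a record contributes a nonnegative sum. This confines orbits, and hence the
component of 0. -/
theorem partialSum_iterate_nonneg (n : ℕ) (u : ℤ) :
    0 ≤ partialSum x u ((recordMap x)^[n] u) := by
  induction n generalizing u with
  | zero => simp [partialSum_self]
  | succ n ih =>
    rw [Function.iterate_succ_apply,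
      ← partialSum_add x (le_recordMap u) (le_iterate_recordMap n _)]
    exact add_nonneg (partialSum_recordMap_nonneg u) (ih _)

/-- Edges of the record graph do not cross. -/
theorem exists_iterate_eq_recordMap {v u : ℤ} (h1 : v < u) (h2 : u ≤ recordMap x v) :
    ∃ n : ℕ, (recordMap x)^[n] u = recordMap x v := by
  have hv : recordMap x v ≠ v := by omega
  have h3 := recordMap_spec hv
  induction hd : (recordMap x v - u).toNat using Nat.strong_induction_on generalizing u with
  | _ d ih =>
    rcases h2.eq_or_lt with h | h
    · exact ⟨0, h⟩
    · have h4 := h3.2.2 u h1 h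
      -- As y(v,u) < 0 ≤ y(v,R(v)), the sum from u to R(v) is nonnegative, so the record of u does
      -- not overshoot R(v); iterate.
      have h5 := partialSum_add x h1.le h2
      obtain ⟨h6, h7⟩ := recordMap_of_nonneg h (show 0 ≤ partialSum x u (recordMap x v) by omega)
      obtain ⟨n, hn⟩ := ih _ (by omega) (h1.trans h6) h7 rfl
      exact ⟨n + 1, hn⟩

/-- The point u lies under one of the jumps of the orbit of v; by non-crossing, its own orbit
reaches the end of that jump and then follows the orbit of v. -/
theorem exists_iterate_eq_iterate {v u : ℤ} {m : ℕ} (h1 : v ≤ u) (h2 : u ≤ (recordMap x)^[m] v) :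
    ∃ n : ℕ, (recordMap x)^[n] u = (recordMap x)^[m] v := by
  induction m generalizing v with
  | zero => exact ⟨0, h2.antisymm h1⟩
  | succ m ih =>
    rcases h1.eq_or_lt with rfl | h1
    · exact ⟨m + 1, rfl⟩
    rw [Function.iterate_succ_apply] at h2 ⊢
    rcases le_total (recordMap x v) u with h | h
    · exact ih h h2
    · obtain ⟨n, hn⟩ := exists_iterate_eq_recordMap h1 h
      refine ⟨m + n, ?_⟩
      rw [Function.iterate_add_apply, hn]

/-- Since v lies strictly before the record i of u, y(u,v) < 0, while y(u,i) = y(u,v) + y(v,i). So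
partial sums up to the parent list siblings in increasing order. -/
theorem partialSum_lt_of_siblings {u v i : ℤ} (hu : recordMap x u = i)
    (hv : recordMap x v = i) (hv' : v ≠ i) (huv : u < v) :
    partialSum x u i < partialSum x v i := by
  have hvi : v < i := by have := le_recordMap (x := x) v; omega
  have h1 := recordMap_spec (x := x) (n := u) (by omega)
  rw [hu] at h1
  have h3 := h1.2.2 v huv hvi
  have h4 := partialSum_add x huv.le hvi.le
  omega

theorem partialSum_lt_iff_of_siblings {u v i : ℤ} (hu : recordMap x u = i) (hu' : u ≠ i)
    (hv : recordMap x v = i) (hv' : v ≠ i) :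
    partialSum x u i < partialSum x v i ↔ u < v := by
  refine ⟨fun h => ?_, partialSum_lt_of_siblings hu hv hv'⟩
  rcases lt_trichotomy u v with h' | rfl | h'
  · exact h'
  · exact absurd h (lt_irrefl _)
  · exact absurd (partialSum_lt_of_siblings hv hu hu' h') h.asymm

theorem eq_of_partialSum_eq_of_siblings {u v i : ℤ} (hu : recordMap x u = i) (hu' : u ≠ i)
    (hv : recordMap x v = i) (hv' : v ≠ i) (h : partialSum x u i = partialSum x v i) : u = v := by
  rcases lt_trichotomy u v with h' | h' | h'
  · exact absurd h (partialSum_lt_of_siblings hu hv hv' h').ne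
  · exact h'
  · exact absurd h (partialSum_lt_of_siblings hv hu hu' h').ne'

theorem partialSum_le_of_recordMap_eq {u i : ℤ} (hu : recordMap x u = i) (hu' : u ≠ i) :
    partialSum x u i ≤ x (i - 1) := by
  have hui : u < i := by have := le_recordMap (x := x) u; omega
  rcases (show u ≤ i - 1 by omega).eq_or_lt with h | h
  · rw [h, partialSum_pred]
  · have h1 := (recordMap_spec (x := x) (n := u) (by omega)).2.2 (i - 1) h (by omega)
    have h4 := partialSum_add x h.le (show i - 1 ≤ i by omega)
    rw [partialSum_pred] at h4
    omega

namespace DriftsDown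

/-- Every value between `0` and `x_{i-1}` is attained by a child of `i`. -/
theorem exists_child (hx : DriftsDown x) {i k : ℤ} (hk : 0 ≤ k) (hk' : k ≤ x (i - 1)) :
    ∃ u, recordMap x u = i ∧ u ≠ i ∧ partialSum x u i = k := by
  obtain ⟨L, hL⟩ := hx.backward i
  -- Going left from i, take the first u at which y(u,i) is at most k. Steps down have size at most
  -- one, so the level k is hit exactly, and y(u,j) = k - y(j,i) < 0 for u < j < i makes i the
  -- record of u.
  obtain ⟨u, ⟨hui, huk⟩, hmax⟩ := Int.exists_greatest_of_bdd
    (P := fun u => u < i ∧ partialSum x u i ≤ k) ⟨i, fun z hz => hz.1.le⟩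
    ⟨min L (i - 1), by omega, (hL _ (min_le_left _ _)).le.trans hk⟩
  have hgt : ∀ j, u < j → j < i → k < partialSum x j i := by
    intro j hj hji
    by_contra hc
    exact absurd (hmax j ⟨hji, not_lt.mp hc⟩) (not_le.mpr hj)
  have heq : partialSum x u i = k := by
    refine huk.antisymm ?_
    rcases (show u ≤ i - 1 by omega).eq_or_lt with h | h
    · rw [h, partialSum_pred]; exact hk'
    · have h1 := hgt (u + 1) (by omega) (by omega)
      have h2 := partialSum_succ_left (x := x) hui
      have h3 := hx.ge_neg_one u
      omega
  refine ⟨u, recordMap_eq hui (by omega) fun j hj hji => ?_, hui.ne, heq⟩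
  have h1 := hgt j hj hji
  have h2 := partialSum_add x hj.le hji.le
  omega

/-- The number of children of `i`. -/
theorem ncard_children (hx : DriftsDown x) (i : ℤ) :
    {u | recordMap x u = i ∧ u ≠ i}.ncard = (x (i - 1) + 1).toNat := by
  have hinj : Set.InjOn (fun u => partialSum x u i) {u | recordMap x u = i ∧ u ≠ i} :=
    fun u hu v hv h => eq_of_partialSum_eq_of_siblings hu.1 hu.2 hv.1 hv.2 h
  have himg : (fun u => partialSum x u i) '' {u | recordMap x u = i ∧ u ≠ i}
      = ↑(Finset.Icc 0 (x (i - 1))) := by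
    ext k
    simp only [Set.mem_image, Set.mem_ofPred_eq, Finset.coe_Icc, Set.mem_Icc]
    constructor
    · rintro ⟨u, ⟨h1, h2⟩, rfl⟩
      refine ⟨?_, partialSum_le_of_recordMap_eq h1 h2⟩
      rw [← h1]
      exact partialSum_recordMap_nonneg u
    · rintro ⟨h1, h2⟩
      obtain ⟨u, h3, h4, h5⟩ := hx.exists_child h1 h2
      exact ⟨u, ⟨h3, h4⟩, h5⟩
  rw [← hinj.ncard_image, himg, Set.ncard_coe_finset, Int.card_Icc, sub_zero]

end DriftsDown

end RecordMap

/-! ### The component of `0` -/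

section Component

variable {x : ℤ → ℤ}

/-- The vertex set of the component of `0` in the record graph. -/
def recordComponentSet (x : ℤ → ℤ) : Set ℤ :=
  {v | ∃ m n : ℕ, (recordMap x)^[m] v = (recordMap x)^[n] 0}

/-- The graph of the record map on the component of `0`. -/
def recordGraph (x : ℤ → ℤ) : Set (ℤ × ℤ) :=
  {p | p.1 ∈ recordComponentSet x ∧ recordMap x p.1 = p.2}

theorem zero_mem_recordComponentSet : 0 ∈ recordComponentSet x := ⟨0, 0, rfl⟩

theorem exists_common_iterate {u v : ℤ} (hu : u ∈ recordComponentSet x)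
    (hv : v ∈ recordComponentSet x) :
    ∃ m n : ℕ, (recordMap x)^[m] u = (recordMap x)^[n] v := by
  obtain ⟨a, b, hu⟩ := hu
  obtain ⟨c, d, hv⟩ := hv
  refine ⟨d + a, b + c, ?_⟩
  rw [Function.iterate_add_apply, Function.iterate_add_apply, hu, hv,
    ← Function.iterate_add_apply, ← Function.iterate_add_apply, add_comm]

theorem mem_recordComponentSet_of_iterate {u v : ℤ} (hv : v ∈ recordComponentSet x) {m n : ℕ}
    (h : (recordMap x)^[m] u = (recordMap x)^[n] v) : u ∈ recordComponentSet x := by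
  obtain ⟨c, d, hv⟩ := hv
  refine ⟨c + m, n + d, ?_⟩
  rw [Function.iterate_add_apply, h, ← Function.iterate_add_apply, add_comm c n,
    Function.iterate_add_apply, hv, ← Function.iterate_add_apply]

theorem recordMap_mem_iff {u : ℤ} :
    recordMap x u ∈ recordComponentSet x ↔ u ∈ recordComponentSet x :=
  ⟨fun h => mem_recordComponentSet_of_iterate (m := 1) (n := 0) h rfl,
    fun h => mem_recordComponentSet_of_iterate (m := 0) (n := 1) h rfl⟩

/-- The component is an interval: u and w have a common image, which lies to the right of w, and
non-crossing leads the orbit of v to it. -/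
theorem mem_recordComponentSet_of_mem_Icc {u v w : ℤ} (hu : u ∈ recordComponentSet x)
    (hw : w ∈ recordComponentSet x) (h1 : u ≤ v) (h2 : v ≤ w) : v ∈ recordComponentSet x := by
  obtain ⟨m, n, h⟩ := exists_common_iterate hu hw
  have h3 : v ≤ (recordMap x)^[m] u := h2.trans ((le_iterate_recordMap n w).trans h.ge)
  obtain ⟨k, hk⟩ := exists_iterate_eq_iterate h1 h3
  exact mem_recordComponentSet_of_iterate hu hk

theorem DriftsDown.finite_recordComponentSet (hx : DriftsDown x) :
    (recordComponentSet x).Finite := by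
  obtain ⟨J, hJ⟩ := hx.forward 0
  choose L hL using hx.backward
  -- The orbit of 0 stays in [0, J), where `L` takes finitely many values. A vertex v meets that
  -- orbit at some j with y(v,j) ≥ 0, so v cannot lie below all of them.
  obtain ⟨K, hK⟩ : ∃ K, ∀ j ∈ Set.Icc 0 J, K ≤ L j := by
    obtain ⟨K, hK⟩ := ((Set.finite_Icc (0 : ℤ) J).image L).bddBelow
    exact ⟨K, fun j hj => hK ⟨j, hj, rfl⟩⟩
  refine (Set.finite_Icc K J).subset ?_
  rintro v ⟨m, n, h⟩
  have h1 := le_iterate_recordMap (x := x) n 0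
  have h2 : (recordMap x)^[n] 0 < J := by
    by_contra hc
    exact absurd (hJ _ (not_lt.mp hc)) (not_lt.mpr (partialSum_iterate_nonneg n 0))
  have h3 := le_iterate_recordMap (x := x) m v
  have h4 := partialSum_iterate_nonneg (x := x) m v
  rw [h] at h3 h4
  refine ⟨?_, by omega⟩
  by_contra hc
  have h5 := hK _ ⟨h1, h2.le⟩
  exact absurd (hL _ v (by omega)) (not_lt.mpr h4)

theorem DriftsDown.finite_recordGraph (hx : DriftsDown x) : (recordGraph x).Finite := by
  refine (hx.finite_recordComponentSet.image fun u => (u, recordMap x u)).subset ?_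
  rintro ⟨u, v⟩ ⟨h1, h2⟩
  exact ⟨u, h1, Prod.ext rfl h2⟩

theorem recordComponentSet_eq_of_recordGraph_eq {x x' : ℤ → ℤ}
    (h : recordGraph x = recordGraph x') : recordComponentSet x = recordComponentSet x' := by
  ext u
  exact ⟨fun hu => ((Set.ext_iff.mp h (u, recordMap x u)).mp ⟨hu, rfl⟩).1,
    fun hu => ((Set.ext_iff.mp h (u, recordMap x' u)).mpr ⟨hu, rfl⟩).1⟩

theorem recordMap_eq_of_recordGraph_eq {x x' : ℤ → ℤ} (h : recordGraph x = recordGraph x')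
    {u : ℤ} (hu : u ∈ recordComponentSet x) : recordMap x u = recordMap x' u :=
  (((Set.ext_iff.mp h (u, recordMap x u)).mp ⟨hu, rfl⟩).2).symm

/-- The offspring numbers in the component are determined by the record map on it. -/
theorem DriftsDown.apply_eq_of_recordGraph_eq {x x' : ℤ → ℤ} (hx : DriftsDown x)
    (hx' : DriftsDown x') (h : recordGraph x = recordGraph x') {v : ℤ}
    (hv : v ∈ recordComponentSet x) : x (v - 1) = x' (v - 1) := by
  -- Children of a vertex of the component belong to the component, so the two record maps give v
  -- the same children; their number is x_{v-1}+1.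
  have hs : {u | recordMap x u = v ∧ u ≠ v} = {u | recordMap x' u = v ∧ u ≠ v} := by
    ext u
    constructor
    · rintro ⟨h1, h2⟩
      refine ⟨?_, h2⟩
      rw [← recordMap_eq_of_recordGraph_eq h, h1]
      rwa [← recordMap_mem_iff, h1]
    · rintro ⟨h1, h2⟩
      refine ⟨?_, h2⟩
      rw [recordMap_eq_of_recordGraph_eq h, h1]
      rwa [recordComponentSet_eq_of_recordGraph_eq h, ← recordMap_mem_iff, h1,
        ← recordComponentSet_eq_of_recordGraph_eq h]
  have h1 := hx.ncard_children v
  have h2 := hx'.ncard_children v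
  rw [hs, h2] at h1
  have h3 := hx.ge_neg_one (v - 1)
  have h4 := hx'.ge_neg_one (v - 1)
  omega

theorem RecordComponent.parent_eq_some_iff {u v : RecordComponent x} :
    RecordComponent.parent x u = some v ↔ recordMap x u.1 = v.1 ∧ u.1 ≠ v.1 := by
  constructor
  · intro h
    obtain ⟨h1, h2⟩ := RecordComponent.parent_eq_some x h
    exact ⟨h1, fun h3 => h2 (h1.trans h3.symm)⟩
  · rintro ⟨h1, h2⟩
    unfold RecordComponent.parent
    rw [if_neg (by rw [h1]; exact h2.symm)]
    exact congrArg some (Subtype.ext h1)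

end Component

/-! ### Rigidity of the component of `0` -/

namespace OrderedFamilyTree

variable {V W : Type}

/-- The depth-first order of an ordered Family Tree: descendants precede their ancestors, and
descendants of smaller siblings precede those of larger ones. -/
def Precedes (T : OrderedFamilyTree V) (u v : V) : Prop :=
  (u ≠ v ∧ ∃ n : ℕ, T.shift^[n] u = v) ∨ ∃ m n : ℕ, T.lt (T.shift^[m] u) (T.shift^[n] v)

theorem shift_eq_of_parent {T : OrderedFamilyTree V} {u p : V} (h : T.parent u = some p) :
    T.shift u = p := by
  simp [shift, parentShift, h]

theorem shift_eq_of_parent_none {T : OrderedFamilyTree V} {u : V} (h : T.parent u = none) :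
    T.shift u = u := by
  simp [shift, parentShift, h]

/-- Take a common image of u and v reached with the fewest steps in total. Either one vertex is an
ancestor of the other, or the last vertices before the meeting are distinct siblings. -/
theorem precedes_total (T : OrderedFamilyTree V) {u v : V} (h : u ≠ v) :
    T.Precedes u v ∨ T.Precedes v u := by
  classical
  have hex : ∃ s, ∃ k l : ℕ, k + l = s ∧ T.shift^[k] u = T.shift^[l] v := by
    obtain ⟨m, n, hmn⟩ := T.connected u v
    exact ⟨_, m, n, rfl, hmn⟩
  obtain ⟨k, l, hkl, heq⟩ := Nat.find_spec hex
  have hmin : ∀ k' l' : ℕ, k' + l' < k + l → T.shift^[k'] u ≠ T.shift^[l'] v :=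
    fun k' l' hlt hc => Nat.find_min hex (hkl ▸ hlt) ⟨k', l', rfl, hc⟩
  rcases k with _ | k
  · exact Or.inr (Or.inl ⟨h.symm, l, heq.symm⟩)
  rcases l with _ | l
  · exact Or.inl (Or.inl ⟨h, k + 1, heq⟩)
  have hu : T.shift (T.shift^[k] u) = T.shift (T.shift^[l] v) := by
    rw [← Function.iterate_succ_apply' T.shift, ← Function.iterate_succ_apply' T.shift, heq]
  rcases hp : T.parent (T.shift^[k] u) with _ | p
  · refine absurd ?_ (hmin k (l + 1) (by omega))
    rw [Function.iterate_succ_apply' T.shift, ← hu, shift_eq_of_parent_none hp]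
  rcases hq : T.parent (T.shift^[l] v) with _ | q
  · refine absurd ?_ (hmin (k + 1) l (by omega))
    rw [Function.iterate_succ_apply' T.shift, hu, shift_eq_of_parent_none hq]
  rw [shift_eq_of_parent hp, shift_eq_of_parent hq] at hu
  subst hu
  rcases T.lt_trichotomous _ _ _ hp hq with h1 | h1 | h1
  · exact Or.inl (Or.inr ⟨k, l, h1⟩)
  · exact absurd h1 (hmin k l (by omega))
  · exact Or.inr (Or.inr ⟨l, k, h1⟩)

theorem shift_map {T : OrderedFamilyTree V} {S : OrderedFamilyTree W} (e : V ≃ W)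
    (he : ∀ u v, T.parent u = some v ↔ S.parent (e u) = some (e v)) (u : V) :
    e (T.shift u) = S.shift (e u) := by
  rcases hp : T.parent u with _ | p
  · have hq : S.parent (e u) = none := by
      rcases hq : S.parent (e u) with _ | q
      · rfl
      · rw [← e.apply_symm_apply q, ← he, hp] at hq
        cases hq
    simp [shift, parentShift, hp, hq]
  · rw [shift_eq_of_parent hp, shift_eq_of_parent ((he _ _).mp hp)]

theorem shift_iterate_map {T : OrderedFamilyTree V} {S : OrderedFamilyTree W} (e : V ≃ W)
    (he : ∀ u v, T.parent u = some v ↔ S.parent (e u) = some (e v)) (n : ℕ) (u : V) :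
    e (T.shift^[n] u) = S.shift^[n] (e u) :=
  Function.Semiconj.iterate_right (fun u => shift_map e he u) n u

theorem Precedes.map {T : OrderedFamilyTree V} {S : OrderedFamilyTree W} (e : V ≃ W)
    (he : ∀ u v, T.parent u = some v ↔ S.parent (e u) = some (e v))
    (hlt : ∀ u v, T.lt u v ↔ S.lt (e u) (e v)) {u v : V} (h : T.Precedes u v) :
    S.Precedes (e u) (e v) := by
  rcases h with ⟨h1, n, h2⟩ | ⟨m, n, h⟩
  · exact Or.inl ⟨e.injective.ne h1, n, by rw [← shift_iterate_map e he, h2]⟩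
  · refine Or.inr ⟨m, n, ?_⟩
    rwa [← shift_iterate_map e he, ← shift_iterate_map e he, ← hlt]

end OrderedFamilyTree

namespace RecordComponent

variable {x x' : ℤ → ℤ}

theorem shift_iterate_val (n : ℕ) (u : RecordComponent x) :
    ((tree x).shift^[n] u).1 = (recordMap x)^[n] u.1 := iterate_val x n u

/-- In the component of `0`, the depth-first order is the order of the integers. -/
theorem lt_of_precedes {u v : RecordComponent x} (h : (tree x).Precedes u v) : u.1 < v.1 := by
  rcases h with ⟨h1, n, rfl⟩ | ⟨m, n, ⟨p, hp, hq⟩, hlt⟩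
  · refine lt_of_le_of_ne ?_ (fun h => h1 (Subtype.ext h))
    rw [shift_iterate_val]
    exact le_iterate_recordMap n _
  · rw [parent_eq_some_iff, shift_iterate_val] at hp hq
    rw [shift_iterate_val, shift_iterate_val] at hlt
    refine lt_of_le_of_lt (le_iterate_recordMap (x := x) m u.1) ?_
    -- Suppose v lies weakly left of the smaller sibling a, with b the larger one. Then a lies
    -- between v and its image b, so some iterate of a equals b by non-crossing. But a ≠ b, and the
    -- parent of a is already to the right of b.
    by_contra hc
    obtain ⟨k, hk⟩ := exists_iterate_eq_iterate (not_lt.mp hc) hlt.le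
    rcases k with _ | k
    · exact hlt.ne hk
    · have h1 := le_iterate_recordMap (x := x) k (recordMap x ((recordMap x)^[m] u.1))
      rw [← Function.iterate_succ_apply, hk, hp.1, ← hq.1] at h1
      have h2 := le_recordMap (x := x) ((recordMap x)^[n] v.1)
      have h3 := hq.2
      omega

/-- The domain is an interval containing 0, so one can walk from 0 to v in unit steps, each raising
the image by at least one. Applied to a bijection and to its inverse, this gives the identity. -/
theorem le_apply_of_strictMono (e : RecordComponent x → RecordComponent x')
    (he : ∀ u v : RecordComponent x, u.1 < v.1 → (e u).1 < (e v).1)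
    (h0 : (e ⟨0, 0, 0, rfl⟩).1 = 0) (v : RecordComponent x) (hv : 0 ≤ v.1) : v.1 ≤ (e v).1 := by
  obtain ⟨v, hv'⟩ := v
  simp only at hv
  induction v, hv using Int.leInduction with
  | base => exact h0.ge
  | succ n hn ih =>
    have hn' : n ∈ recordComponentSet x :=
      mem_recordComponentSet_of_mem_Icc zero_mem_recordComponentSet hv' hn (by omega)
    have h1 := ih hn'
    have h2 := he ⟨n, hn'⟩ ⟨n + 1, hv'⟩ (by simp)
    simp only at h1 h2 ⊢
    omega

theorem apply_le_of_strictMono (e : RecordComponent x → RecordComponent x')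
    (he : ∀ u v : RecordComponent x, u.1 < v.1 → (e u).1 < (e v).1)
    (h0 : (e ⟨0, 0, 0, rfl⟩).1 = 0) (v : RecordComponent x) (hv : v.1 ≤ 0) : (e v).1 ≤ v.1 := by
  obtain ⟨v, hv'⟩ := v
  simp only at hv
  induction v, hv using Int.leInductionDown with
  | base => exact h0.le
  | pred n hn ih =>
    have hn' : n ∈ recordComponentSet x :=
      mem_recordComponentSet_of_mem_Icc hv' zero_mem_recordComponentSet (by omega) hn
    have h1 := ih hn'
    have h2 := he ⟨n - 1, hv'⟩ ⟨n, hn'⟩ (by simp)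
    simp only at h1 h2 ⊢
    omega

theorem apply_val_eq_of_strictMono (e : RecordComponent x ≃ RecordComponent x')
    (he : ∀ u v : RecordComponent x, u.1 < v.1 → (e u).1 < (e v).1)
    (h0 : e ⟨0, 0, 0, rfl⟩ = ⟨0, 0, 0, rfl⟩) (v : RecordComponent x) : (e v).1 = v.1 := by
  have h0' : e.symm ⟨0, 0, 0, rfl⟩ = ⟨0, 0, 0, rfl⟩ := by rw [e.symm_apply_eq, h0]
  have he' : ∀ u v : RecordComponent x', u.1 < v.1 → (e.symm u).1 < (e.symm v).1 := by
    intro u v huv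
    by_contra hc
    rcases (not_lt.mp hc).eq_or_lt with h | h
    · exact huv.ne' (congrArg Subtype.val (e.symm.injective (Subtype.ext h)))
    · have := he _ _ h
      simp only [Equiv.apply_symm_apply] at this
      omega
  have h1 : (⟨0, 0, 0, rfl⟩ : RecordComponent x').1 = 0 := rfl
  rcases le_total 0 v.1 with h | h
  · have h2 := le_apply_of_strictMono e he (by rw [h0]) v h
    have h3 := le_apply_of_strictMono e.symm he' (by rw [h0']) (e v) (h.trans h2)
    rw [e.symm_apply_apply] at h3
    omega
  · have h2 := apply_le_of_strictMono e he (by rw [h0]) v h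
    have h3 := apply_le_of_strictMono e.symm he' (by rw [h0']) (e v) (h2.trans h)
    rw [e.symm_apply_apply] at h3
    omega

/-- The isomorphism class of the component of `0` determines the record map on it. -/
theorem recordGraph_eq_of_iso (h : (rooted x).Iso (rooted x')) :
    recordGraph x = recordGraph x' := by
  obtain ⟨(e : RecordComponent x ≃ RecordComponent x'), h1, h2, h3⟩ := h
  have hmono : ∀ u v : RecordComponent x, u.1 < v.1 → (e u).1 < (e v).1 := by
    intro u v huv
    have hne : u ≠ v := fun h => huv.ne (congrArg Subtype.val h)
    rcases (tree x).precedes_total hne with h | h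
    · exact lt_of_precedes (x := x') (h.map e h2 h3)
    · exact absurd (lt_of_precedes h) huv.asymm
  have hid : ∀ v : RecordComponent x, (e v).1 = v.1 :=
    apply_val_eq_of_strictMono e hmono (h1 0)
  have hR : ∀ v : RecordComponent x, recordMap x v.1 = recordMap x' v.1 := by
    intro v
    have h4 := congrArg Subtype.val (OrderedFamilyTree.shift_map (T := tree x) (S := tree x') e h2 v)
    rw [hid] at h4
    have h5 := shift_iterate_val 1 v
    have h6 := shift_iterate_val (x := x') 1 (e v)
    simp only [Function.iterate_one] at h5 h6
    rw [h5, h6, hid] at h4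
    exact h4
  ext ⟨u, v⟩
  constructor
  · rintro ⟨hu, huv⟩
    refine ⟨?_, (hR ⟨u, hu⟩).symm.trans huv⟩
    have := (e ⟨u, hu⟩).2
    rwa [hid] at this
  · rintro ⟨hu, huv⟩
    have h4 : (e.symm ⟨u, hu⟩).1 = u := by rw [← hid, e.apply_symm_apply]
    have h5 := (e.symm ⟨u, hu⟩).2
    have h6 := hR (e.symm ⟨u, hu⟩)
    rw [h4] at h5 h6
    exact ⟨h5, h6.trans huv⟩

/-- The record map on the component of `0` determines the component with any choice of roots. -/
theorem mk_eq_of_recordGraph_eq (h : recordGraph x = recordGraph x') {k : ℕ}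
    (r : Fin k → RecordComponent x) (r' : Fin k → RecordComponent x')
    (hr : ∀ i, (r i).1 = (r' i).1) :
    FamilyTreeSpace.mk ⟨RecordComponent x, tree x, r⟩ =
      FamilyTreeSpace.mk ⟨RecordComponent x', tree x', r'⟩ := by
  have hs : ∀ u, u ∈ recordComponentSet x ↔ u ∈ recordComponentSet x' := by
    rw [recordComponentSet_eq_of_recordGraph_eq h]; simp
  have hp : ∀ u v : RecordComponent x, parent x u = some v ↔
      parent x' ⟨u.1, (hs _).mp u.2⟩ = some ⟨v.1, (hs _).mp v.2⟩ := by
    intro u v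
    rw [parent_eq_some_iff, parent_eq_some_iff, recordMap_eq_of_recordGraph_eq h u.2]
  let e : RecordComponent x ≃ RecordComponent x' := Equiv.subtypeEquivRight hs
  refine Quotient.sound ⟨e, fun i => Subtype.ext (hr i), hp, fun u v => ?_⟩
  refine and_congr ⟨?_, ?_⟩ Iff.rfl
  · rintro ⟨p, h1, h2⟩
    exact ⟨e p, (hp _ _).mp h1, (hp _ _).mp h2⟩
  · rintro ⟨p, h1, h2⟩
    refine ⟨e.symm p, (hp _ _).mpr ?_, (hp _ _).mpr ?_⟩
    · exact h1
    · exact h2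

end RecordComponent

/-! ### Coding the component of `0` -/

namespace DriftsDown

variable {x : ℤ → ℤ}

/-- Otherwise the orbit of 0 would be a strictly increasing sequence in the finite component. -/
theorem exists_top (hx : DriftsDown x) :
    ∃ n : ℕ, (recordMap x)^[n + 1] 0 = (recordMap x)^[n] 0 := by
  by_contra! hc
  have hlt : ∀ n : ℕ, (recordMap x)^[n] 0 < (recordMap x)^[n + 1] 0 := fun n =>
    lt_of_le_of_ne (by rw [Function.iterate_succ_apply']; exact le_recordMap _) (hc n).symm
  refine Set.infinite_of_injective_forall_mem (strictMono_nat_of_lt_succ hlt).injective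
    (fun n => ?_) hx.finite_recordComponentSet
  exact ⟨0, n, rfl⟩

end DriftsDown

namespace RecordCode

open Classical in
/-- The number of ancestors of `0` in the record graph. -/
noncomputable def height (x : ℤ → ℤ) : ℕ :=
  if h : ∃ n : ℕ, (recordMap x)^[n + 1] 0 = (recordMap x)^[n] 0 then Nat.find h else 0

/-- The datum of the `(i + 1)`-st ancestor of `0`. -/
noncomputable def spine (x : ℤ → ℤ) (i : ℕ) : ℕ × ℕ :=
  ((x ((recordMap x)^[i + 1] 0 - 1)).toNat,
    (partialSum x ((recordMap x)^[i] 0) ((recordMap x)^[i + 1] 0)).toNat)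

open Classical in
/-- The child in position `j` of `v`. -/
noncomputable def child (x : ℤ → ℤ) (v : ℤ) (j : ℕ) : ℤ :=
  if h : ∃ u, recordMap x u = v ∧ u ≠ v ∧ partialSum x u v = j then h.choose else v

/-- The integer with code `(i, w)`. -/
noncomputable def decode (x : ℤ → ℤ) (i : ℕ) : List ℕ → ℤ
  | [] => (recordMap x)^[i] 0
  | j :: w => child x (decode x i w) j

/-- The number of children of the integer with code `(i, w)`. -/
noncomputable def offspring (x : ℤ → ℤ) (p : ℕ × List ℕ) : ℕ :=
  (x (decode x p.1 p.2 - 1) + 1).toNat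

/-- Data for a Family Tree that agree with the component of `0`. -/
structure Compatible (x : ℤ → ℤ) (N : ℕ) (sp : ℕ → ℕ × ℕ) (ξ : ℕ × List ℕ → ℕ) : Prop where
  height_eq : N = height x
  spine_eq : ∀ i < N, sp i = spine x i
  offspring_root : ξ (0, []) = offspring x (0, [])
  offspring_eq : ∀ i j w, TGWT.IsVertex N sp ξ i (j :: w) → ξ (i, j :: w) = offspring x (i, j :: w)

variable {x : ℤ → ℤ}

theorem recordMap_iterate_zero (i : ℕ) :
    recordMap x ((recordMap x)^[i] 0) = (recordMap x)^[i + 1] 0 :=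
  (Function.iterate_succ_apply' (recordMap x) i 0).symm

theorem iterate_height (hx : DriftsDown x) :
    recordMap x ((recordMap x)^[height x] 0) = (recordMap x)^[height x] 0 := by
  have h := hx.exists_top
  rw [height, dif_pos h, ← Function.iterate_succ_apply' (recordMap x)]
  exact Nat.find_spec h

theorem iterate_ne_of_lt_height {i : ℕ} (hi : i < height x) :
    (recordMap x)^[i] 0 ≠ (recordMap x)^[i + 1] 0 := by
  unfold height at hi
  split_ifs at hi with h
  · exact fun h' => Nat.find_min h hi h'.symm
  · omega

theorem iterate_of_height_le (hx : DriftsDown x) {i : ℕ} (hi : height x ≤ i) :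
    (recordMap x)^[i] 0 = (recordMap x)^[height x] 0 := by
  obtain ⟨d, rfl⟩ := Nat.exists_eq_add_of_le hi
  rw [add_comm, Function.iterate_add_apply]
  exact Function.iterate_fixed (iterate_height hx) d

theorem child_spec (hx : DriftsDown x) {v : ℤ} {j : ℕ} (hj : j < (x (v - 1) + 1).toNat) :
    recordMap x (child x v j) = v ∧ child x v j ≠ v ∧ partialSum x (child x v j) v = j := by
  have h := hx.exists_child (i := v) (k := j) (by omega) (by omega)
  rw [child, dif_pos h]
  exact h.choose_spec

/-! ### Decoding as an isomorphism onto the component of 0 -/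

variable {N : ℕ} {sp : ℕ → ℕ × ℕ} {ξ : ℕ × List ℕ → ℕ}

namespace Compatible

theorem lt_of_isPosition (hc : Compatible x N sp ξ) {i : ℕ} {w : List ℕ}
    {j : ℕ} (hv : TGWT.IsVertex N sp ξ i w) (hj : TGWT.IsPosition sp ξ i w j) :
    j < (x (decode x i w - 1) + 1).toNat := by
  rcases w with _ | ⟨a, w⟩
  · rcases i with _ | i
    · have h : j < ξ (0, []) := hj
      rwa [hc.offspring_root] at h
    · obtain ⟨h1, -⟩ := hj
      rw [hc.spine_eq i hv] at h1
      simp only [spine] at h1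
      -- An ancestor has at least one child, the spine vertex, so its increment is nonnegative and
      -- the truncation `toNat` in `spine` loses nothing.
      have hne := iterate_ne_of_lt_height (x := x) (i := i) (hc.height_eq ▸ hv)
      have h2 := partialSum_le_of_recordMap_eq
        (recordMap_iterate_zero i) hne
      have h3 := partialSum_recordMap_nonneg (x := x) ((recordMap x)^[i] 0)
      rw [recordMap_iterate_zero] at h3
      simp only [decode]
      omega
  · have h : j < ξ (i, a :: w) := by
      cases i <;> exact hj
    rwa [hc.offspring_eq i a w hv] at h

theorem decode_cons (hx : DriftsDown x) (hc : Compatible x N sp ξ) {i : ℕ} {w : List ℕ}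
    {j : ℕ} (hv : TGWT.IsVertex N sp ξ i (j :: w)) :
    recordMap x (decode x i (j :: w)) = decode x i w ∧ decode x i (j :: w) ≠ decode x i w ∧
      partialSum x (decode x i (j :: w)) (decode x i w) = j :=
  child_spec hx (hc.lt_of_isPosition hv.1 hv.2)

theorem decode_of_parent (hx : DriftsDown x) (hc : Compatible x N sp ξ)
    {u p : TGWT.Vertex N sp ξ} (h : TGWT.parent N sp ξ u = some p) :
    recordMap x (decode x u.1.1 u.1.2) = decode x p.1.1 p.1.2 ∧
      decode x u.1.1 u.1.2 ≠ decode x p.1.1 p.1.2 ∧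
      partialSum x (decode x u.1.1 u.1.2) (decode x p.1.1 p.1.2) = TGWT.position N sp ξ u := by
  obtain ⟨⟨i, w⟩, hu⟩ := u
  rcases w with _ | ⟨j, w⟩
  · simp only [TGWT.parent] at h
    split_ifs at h with h1
    cases h
    refine ⟨(Function.iterate_succ_apply' _ _ _).symm,
      iterate_ne_of_lt_height (x := x) (hc.height_eq ▸ h1), ?_⟩
    have h3 := partialSum_recordMap_nonneg (x := x) ((recordMap x)^[i] 0)
    rw [recordMap_iterate_zero] at h3
    simp only [decode, TGWT.position]
    rw [hc.spine_eq i h1]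
    simp only [spine]
    omega
  · cases h
    exact hc.decode_cons hx hu

theorem eq_top_of_parent_none {u : TGWT.Vertex N sp ξ} (h : TGWT.parent N sp ξ u = none) :
    u = ⟨(N, []), le_refl N⟩ := by
  obtain ⟨⟨i, w⟩, hu⟩ := u
  rcases w with _ | ⟨j, w⟩
  · simp only [TGWT.parent] at h
    split_ifs at h with h1
    have h2 : i ≤ N := hu
    have h3 : i = N := by omega
    subst h3
    rfl
  · cases h

theorem recordMap_decode_of_parent_none (hx : DriftsDown x) (hc : Compatible x N sp ξ)
    {u : TGWT.Vertex N sp ξ} (h : TGWT.parent N sp ξ u = none) :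
    recordMap x (decode x u.1.1 u.1.2) = decode x u.1.1 u.1.2 := by
  rw [eq_top_of_parent_none h]
  have h1 := hc.height_eq
  subst h1
  exact iterate_height hx

theorem decode_parentShift (hx : DriftsDown x) (hc : Compatible x N sp ξ)
    (u : TGWT.Vertex N sp ξ) :
    decode x (parentShift (TGWT.parent N sp ξ) u).1.1 (parentShift (TGWT.parent N sp ξ) u).1.2 =
      recordMap x (decode x u.1.1 u.1.2) := by
  rcases hp : TGWT.parent N sp ξ u with _ | p
  · rw [hc.recordMap_decode_of_parent_none hx hp]
    simp [parentShift, hp]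
  · rw [(hc.decode_of_parent hx hp).1]
    simp [parentShift, hp]

/-- Induction on the number of steps to the top: decoding turns parents into records, so equal
integers have codes with equal parents. The position among siblings is also read off the integer, as
a partial sum. -/
theorem decode_injective (hx : DriftsDown x) (hc : Compatible x N sp ξ)
    {u v : TGWT.Vertex N sp ξ} (h : decode x u.1.1 u.1.2 = decode x v.1.1 v.1.2) : u = v := by
  obtain ⟨n, hn⟩ := TGWT.exists_iterate_eq N sp ξ u
  have none_iff : ∀ {u v : TGWT.Vertex N sp ξ}, decode x u.1.1 u.1.2 = decode x v.1.1 v.1.2 →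
      TGWT.parent N sp ξ u = none → TGWT.parent N sp ξ v = none := by
    intro u v h hu
    rcases hq : TGWT.parent N sp ξ v with _ | q
    · rfl
    · have h1 := hc.recordMap_decode_of_parent_none hx hu
      obtain ⟨h2, h3, -⟩ := hc.decode_of_parent hx hq
      rw [h, h2] at h1
      exact absurd h1.symm h3
  have top : ∀ {u v : TGWT.Vertex N sp ξ}, decode x u.1.1 u.1.2 = decode x v.1.1 v.1.2 →
      TGWT.parent N sp ξ u = none → u = v := fun h hu =>
    (eq_top_of_parent_none hu).trans (eq_top_of_parent_none (none_iff h hu)).symm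
  induction n generalizing u v with
  | zero =>
    refine top h ?_
    have h1 : u = ⟨(N, []), le_refl N⟩ := hn
    rw [h1]
    simp [TGWT.parent]
  | succ n ih =>
    rw [Function.iterate_succ_apply] at hn
    rcases hp : TGWT.parent N sp ξ u with _ | p
    · exact top h hp
    rcases hq : TGWT.parent N sp ξ v with _ | q
    · exact (top h.symm hq).symm
    have hpq : p = q := by
      have := ih (u := parentShift (TGWT.parent N sp ξ) u) (v := parentShift (TGWT.parent N sp ξ) v)
        (by rw [hc.decode_parentShift hx, hc.decode_parentShift hx, h]) hn
      simpa [parentShift, hp, hq] using this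
    subst hpq
    have h1 := (hc.decode_of_parent hx hp).2.2
    have h2 := (hc.decode_of_parent hx hq).2.2
    rw [h] at h1
    exact TGWT.eq_of_position_eq N sp ξ hp hq (by exact_mod_cast h1.symm.trans h2)

theorem decode_mem (hx : DriftsDown x) (hc : Compatible x N sp ξ) (u : TGWT.Vertex N sp ξ) :
    decode x u.1.1 u.1.2 ∈ recordComponentSet x := by
  obtain ⟨⟨i, w⟩, hu⟩ := u
  induction w with
  | nil => exact ⟨0, i, rfl⟩
  | cons j w ih =>
    have h := (hc.decode_cons hx hu).1
    rw [← recordMap_mem_iff, h]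
    exact ih hu.1

theorem exists_decode_eq_of_recordMap (hx : DriftsDown x) (hc : Compatible x N sp ξ) {v : ℤ}
    (p : TGWT.Vertex N sp ξ) (h : decode x p.1.1 p.1.2 = recordMap x v) :
    ∃ u : TGWT.Vertex N sp ξ, decode x u.1.1 u.1.2 = v := by
  by_cases hv : recordMap x v = v
  · exact ⟨p, h.trans hv⟩
  have h1 := partialSum_recordMap_nonneg (x := x) v
  have h2 := partialSum_le_of_recordMap_eq (x := x) rfl (Ne.symm hv)
  have hlt : (partialSum x v (recordMap x v)).toNat < (x (recordMap x v - 1) + 1).toNat := by omega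
  set j := (partialSum x v (recordMap x v)).toNat with hj
  have key : TGWT.IsPosition sp ξ p.1.1 p.1.2 j →
      ∃ u : TGWT.Vertex N sp ξ, decode x u.1.1 u.1.2 = v := by
    intro hpos
    refine ⟨⟨(p.1.1, j :: p.1.2), p.2, hpos⟩, ?_⟩
    have h3 := hc.decode_cons hx (i := p.1.1) (w := p.1.2) (j := j) ⟨p.2, hpos⟩
    rw [h] at h3
    exact eq_of_partialSum_eq_of_siblings h3.1 h3.2.1 rfl (Ne.symm hv) (by rw [h3.2.2]; omega)
  obtain ⟨⟨i, w⟩, hp⟩ := p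
  simp only at h key
  rcases w with _ | ⟨a, w⟩
  · rcases i with _ | i
    · refine key ?_
      change j < ξ (0, [])
      rw [hc.offspring_root, offspring, h]
      exact hlt
    · have hi : i < N := hp
      have hne := iterate_ne_of_lt_height (x := x) (hc.height_eq ▸ hi)
      have h4 := recordMap_iterate_zero (x := x) i
      simp only [decode] at h
      -- The position of v under an ancestor is either the one occupied by the spine, so that v has
      -- code (i, []), or one of the new positions.
      by_cases hji : j = (sp i).2
      · refine ⟨⟨(i, []), hi.le⟩, ?_⟩
        rw [hc.spine_eq i hi] at hji
        simp only [spine] at hji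
        rw [h] at hji hne h4
        have h3 := partialSum_recordMap_nonneg (x := x) ((recordMap x)^[i] 0)
        rw [h4] at h3
        simp only [decode]
        exact eq_of_partialSum_eq_of_siblings h4 hne rfl (Ne.symm hv) (by omega)
      · refine key ⟨?_, hji⟩
        rw [hc.spine_eq i hi]
        simp only [spine]
        rw [h]
        omega
  · have : j < ξ (i, a :: w) := by
      rw [hc.offspring_eq i a w hp, offspring, h]
      exact hlt
    refine key ?_
    cases i <;> exact this

/-- The orbit of 0 is coded by the spine; from a point of it, each vertex of the component is
reached by finitely many passages to a child. -/
theorem exists_decode_eq (hx : DriftsDown x) (hc : Compatible x N sp ξ) {v : ℤ}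
    (hv : v ∈ recordComponentSet x) : ∃ u : TGWT.Vertex N sp ξ, decode x u.1.1 u.1.2 = v := by
  obtain ⟨m, n, h⟩ := hv
  have h0 : ∃ u : TGWT.Vertex N sp ξ, decode x u.1.1 u.1.2 = (recordMap x)^[n] 0 := by
    rcases le_total n N with hn | hn
    · exact ⟨⟨(n, []), hn⟩, rfl⟩
    · refine ⟨⟨(N, []), le_refl N⟩, ?_⟩
      have h1 := hc.height_eq
      subst h1
      exact (iterate_of_height_le hx hn).symm
  rw [← h] at h0
  clear h
  induction m generalizing v with
  | zero => exact h0
  | succ m ih =>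
    rw [Function.iterate_succ_apply] at h0
    obtain ⟨p, hp⟩ := ih h0
    exact hc.exists_decode_eq_of_recordMap hx p hp

/-- Decoding as a bijection from the codes to the component of `0`. -/
noncomputable def vertexEquiv (hx : DriftsDown x) (hc : Compatible x N sp ξ) :
    TGWT.Vertex N sp ξ ≃ RecordComponent x :=
  Equiv.ofBijective (fun u => ⟨decode x u.1.1 u.1.2, hc.decode_mem hx u⟩)
    ⟨fun _ _ h => hc.decode_injective hx (congrArg Subtype.val h), fun v => by
      obtain ⟨u, hu⟩ := hc.exists_decode_eq hx v.2
      exact ⟨u, Subtype.ext hu⟩⟩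

theorem mk_rooted (hx : DriftsDown x) (hc : Compatible x N sp ξ) :
    FamilyTreeSpace.mk (TGWT.rooted N sp ξ) = FamilyTreeSpace.mk (RecordComponent.rooted x) := by
  have hpar : ∀ u v, TGWT.parent N sp ξ u = some v ↔
      RecordComponent.parent x (hc.vertexEquiv hx u) = some (hc.vertexEquiv hx v) := by
    intro u v
    rw [RecordComponent.parent_eq_some_iff]
    constructor
    · intro h
      exact ⟨(hc.decode_of_parent hx h).1, (hc.decode_of_parent hx h).2.1⟩
    · rintro ⟨h1, h2⟩
      change recordMap x (decode x u.1.1 u.1.2) = decode x v.1.1 v.1.2 at h1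
      change decode x u.1.1 u.1.2 ≠ decode x v.1.1 v.1.2 at h2
      rcases hp : TGWT.parent N sp ξ u with _ | p
      · have := hc.recordMap_decode_of_parent_none hx hp
        exact absurd (this.symm.trans h1) h2
      · exact congrArg some
          (hc.decode_injective hx ((hc.decode_of_parent hx hp).1.symm.trans h1))
  refine Quotient.sound ⟨hc.vertexEquiv hx, fun i => rfl, hpar, fun u v => ?_⟩
  have hlt : ∀ p, TGWT.parent N sp ξ u = some p → TGWT.parent N sp ξ v = some p →
      (TGWT.position N sp ξ u < TGWT.position N sp ξ v ↔
        (hc.vertexEquiv hx u).1 < (hc.vertexEquiv hx v).1) := by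
    intro p hu hv
    obtain ⟨h1, h2, h3⟩ := hc.decode_of_parent hx hu
    obtain ⟨h4, h5, h6⟩ := hc.decode_of_parent hx hv
    have h7 := partialSum_lt_iff_of_siblings h1 h2 h4 h5
    rw [h3, h6, Nat.cast_lt] at h7
    exact h7
  constructor
  · rintro ⟨⟨p, hu, hv⟩, h⟩
    exact ⟨⟨_, (hpar _ _).mp hu, (hpar _ _).mp hv⟩, (hlt p hu hv).mp h⟩
  · rintro ⟨⟨p, hu, hv⟩, h⟩
    obtain ⟨q, rfl⟩ := (hc.vertexEquiv hx).surjective p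
    have hu' := (hpar _ _).mpr hu
    have hv' := (hpar _ _).mpr hv
    exact ⟨⟨q, hu', hv'⟩, (hlt q hu' hv').mpr h⟩

end Compatible

theorem compatible_self : Compatible x (height x) (spine x) (offspring x) :=
  ⟨rfl, fun _ _ => rfl, rfl, fun _ _ _ _ => rfl⟩

/-- Whether a code is a vertex depends only on the data at its proper suffixes, which are the codes
of its ancestors within the bush, and these are vertices by induction. -/
theorem isVertex_of_agree {N : ℕ} {sp sp' : ℕ → ℕ × ℕ} {ξ ξ' : ℕ × List ℕ → ℕ}
    (hsp : ∀ i < N, sp' i = sp i) (h0 : ξ' (0, []) = ξ (0, []))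
    (hξ : ∀ i j w, TGWT.IsVertex N sp ξ i (j :: w) → ξ' (i, j :: w) = ξ (i, j :: w))
    (i : ℕ) (w : List ℕ) (h : TGWT.IsVertex N sp' ξ' i w) : TGWT.IsVertex N sp ξ i w := by
  induction w with
  | nil => exact h
  | cons j w ih =>
    have h1 := ih h.1
    refine ⟨h1, ?_⟩
    have h2 := h.2
    rcases w with _ | ⟨a, w⟩
    · rcases i with _ | i
      · change j < ξ' (0, []) at h2
        rw [h0] at h2
        exact h2
      · obtain ⟨h3, h4⟩ := h2
        rw [hsp i h1] at h3 h4
        exact ⟨h3, h4⟩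
    · have h3 : j < ξ' (i, a :: w) := by cases i <;> exact h2
      rw [hξ i a w h1] at h3
      cases i <;> exact h3

/-- Data that agree on the codes of the component of `0` with its canonical data are compatible. -/
theorem compatible_of_agree {sp : ℕ → ℕ × ℕ} {ξ : ℕ × List ℕ → ℕ}
    (hsp : ∀ i < height x, sp i = spine x i) (h0 : ξ (0, []) = offspring x (0, []))
    (hξ : ∀ i j w, TGWT.IsVertex (height x) (spine x) (offspring x) i (j :: w) →
      ξ (i, j :: w) = offspring x (i, j :: w)) : Compatible x (height x) sp ξ :=
  ⟨rfl, hsp, h0, fun i j w h => hξ i j w (isVertex_of_agree hsp h0 hξ i _ h)⟩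

end RecordCode

/-! ### Maps that are constant on the pieces of a countable partition -/

namespace MeasureTheory

variable {Ω D S ι : Type*} [MeasurableSpace Ω] [MeasurableSpace D] [MeasurableSpace S]
  [Countable ι]

/-- No structure of the target is used, so this applies to maps into the space of trees although its
Borel sets are not known explicitly. -/
theorem aemeasurable_of_const_on {μ : Measure Ω} {A : ι → Set Ω} {f : Ω → S}
    (hcover : ∀ᵐ ω ∂μ, ω ∈ ⋃ i, A i) (hA : ∀ i, MeasurableSet (A i))
    (hf : ∀ i, ∀ ω ∈ A i, ∀ ω' ∈ A i, f ω = f ω') : AEMeasurable f μ := by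
  rw [← Measure.restrict_eq_self_of_ae_mem hcover, aemeasurable_iUnion_iff]
  intro i
  rcases (A i).eq_empty_or_nonempty with h | ⟨ω₀, h⟩
  · rw [h, Measure.restrict_empty]
    exact aemeasurable_zero_measure
  · exact aemeasurable_const (b := f ω₀) |>.congr
      ((ae_restrict_mem (hA i)).mono fun ω hω => hf i _ h _ hω)

theorem measure_eq_tsum_inter {μ : Measure Ω} {A : ι → Set Ω}
    (hcover : ∀ᵐ ω ∂μ, ω ∈ ⋃ i, A i) (hA : ∀ i, MeasurableSet (A i))
    (hd : Pairwise (Function.onFun Disjoint A)) (T : Set Ω) : μ T = ∑' i, μ (T ∩ A i) := by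
  conv_lhs => rw [← Measure.restrict_eq_self_of_ae_mem hcover, Measure.restrict_iUnion hd hA]
  rw [Measure.sum_apply_of_countable]
  exact tsum_congr fun i => Measure.restrict_apply' (hA i)

open Classical in
theorem map_apply_of_const_on {μ : Measure Ω} {A : ι → Set Ω} {f : Ω → S} {c : ι → S}
    (hcover : ∀ᵐ ω ∂μ, ω ∈ ⋃ i, A i) (hA : ∀ i, MeasurableSet (A i))
    (hd : Pairwise (Function.onFun Disjoint A)) (hf : ∀ i, ∀ ω ∈ A i, f ω = c i)
    {B : Set S} (hB : MeasurableSet B) :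
    μ.map f B = ∑' i, if c i ∈ B then μ (A i) else 0 := by
  have hfm : AEMeasurable f μ := aemeasurable_of_const_on hcover hA
    fun i ω h ω' h' => (hf i ω h).trans (hf i ω' h').symm
  rw [Measure.map_apply_of_aemeasurable hfm hB, measure_eq_tsum_inter hcover hA hd]
  refine tsum_congr fun i => ?_
  split_ifs with h
  · congr 1
    exact Set.inter_eq_right.mpr fun ω hω => by rw [Set.mem_preimage, hf i ω hω]; exact h
  · convert measure_empty (μ := μ)
    refine Set.eq_empty_of_forall_notMem fun ω hω => h ?_
    rw [← hf i ω hω.2]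
    exact hω.1

/-- Two maps that are constant on the pieces of countable partitions, with the same values, have
the same law if the pieces of the first have at most the measure of those of the second. -/
theorem map_eq_map_of_measure_le {μ : Measure Ω} {ν : Measure D} [IsProbabilityMeasure μ]
    [IsProbabilityMeasure ν] {A : ι → Set Ω} {E : ι → Set D} {f : Ω → S} {g : D → S} {c : ι → S}
    (hcover : ∀ᵐ ω ∂μ, ω ∈ ⋃ i, A i) (hA : ∀ i, MeasurableSet (A i))
    (hE : ∀ i, MeasurableSet (E i)) (hdA : Pairwise (Function.onFun Disjoint A))
    (hdE : Pairwise (Function.onFun Disjoint E)) (hf : ∀ i, ∀ ω ∈ A i, f ω = c i)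
    (hg : ∀ i, ∀ d ∈ E i, g d = c i) (hle : ∀ i, μ (A i) ≤ ν (E i)) :
    AEMeasurable f μ ∧ AEMeasurable g ν ∧ μ.map f = ν.map g := by
  have h1 : ∑' i, μ (A i) = 1 := by
    have := measure_eq_tsum_inter hcover hA hdA Set.univ
    simpa using this.symm
  have h2 : ∑' i, ν (E i) ≤ 1 := by
    rw [← measure_iUnion hdE hE]
    exact prob_le_one
  -- One strict inequality would make the sum of the masses `ν (E i)` exceed 1.
  have heq : ∀ i, μ (A i) = ν (E i) := by
    intro i
    by_contra hc
    have h3 := ENNReal.tsum_lt_tsum (by rw [h1]; exact ENNReal.one_ne_top) hle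
      (lt_of_le_of_ne (hle i) hc)
    rw [h1] at h3
    exact absurd h2 (not_le.mpr h3)
  have hcover' : ∀ᵐ d ∂ν, d ∈ ⋃ i, E i := by
    refine mem_ae_iff.mpr ((prob_compl_eq_zero_iff (MeasurableSet.iUnion hE)).mpr ?_)
    rw [measure_iUnion hdE hE, ← tsum_congr heq, h1]
  refine ⟨aemeasurable_of_const_on hcover hA fun i ω h ω' h' => (hf i ω h).trans (hf i ω' h').symm,
    aemeasurable_of_const_on hcover' hE fun i ω h ω' h' => (hg i ω h).trans (hg i ω' h').symm, ?_⟩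
  ext B hB
  classical
  rw [map_apply_of_const_on hcover hA hdA hf hB, map_apply_of_const_on hcover' hE hdE hg hB]
  simp_rw [heq]

end MeasureTheory

/-! ### Finite trees are isolated points -/

namespace OrderedFamilyTree

variable {V W : Type}

theorem graph_adj_of_parent (T : OrderedFamilyTree V) {u v : V} (h : T.parent u = some v)
    (hne : u ≠ v) : T.graph.Adj u v := by
  rw [graph, SimpleGraph.fromRel_adj]
  exact ⟨hne, Or.inl h⟩

theorem reachable_shift (T : OrderedFamilyTree V) (u : V) : T.graph.Reachable u (T.shift u) := by
  by_cases h : u = T.shift u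
  · rw [← h]
  · rcases hp : T.parent u with _ | p
    · exact absurd (shift_eq_of_parent_none hp).symm h
    · rw [shift_eq_of_parent hp] at h ⊢
      exact (T.graph_adj_of_parent hp h).reachable

theorem reachable_shift_iterate (T : OrderedFamilyTree V) (n : ℕ) (u : V) :
    T.graph.Reachable u (T.shift^[n] u) := by
  induction n with
  | zero => rfl
  | succ n ih =>
    rw [Function.iterate_succ_apply']
    exact ih.trans (T.reachable_shift _)

theorem graph_preconnected (T : OrderedFamilyTree V) : T.graph.Preconnected := by
  intro u v
  obtain ⟨m, n, h⟩ := T.connected u v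
  have h1 := T.reachable_shift_iterate m u
  have h2 := T.reachable_shift_iterate n v
  exact (h1.trans (by rw [show T.shift^[m] u = T.shift^[n] v from h])).trans h2.symm

end OrderedFamilyTree

namespace RootedFamilyTree

variable {k : ℕ}

theorem BallIso.refl (T : RootedFamilyTree k) (r : ℕ) : T.BallIso T r :=
  ⟨Equiv.refl _, fun _ _ => Iff.rfl, fun _ _ => Iff.rfl, fun _ _ => Iff.rfl⟩

theorem dist_lt_card (T : RootedFamilyTree k) [Finite T.V] (u v : T.V) :
    T.tree.graph.dist u v < Nat.card T.V := by
  classical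
  have := Fintype.ofFinite T.V
  obtain ⟨p, hp⟩ := (T.tree.graph_preconnected u v).exists_isPath
  rw [Nat.card_eq_fintype_card]
  exact lt_of_le_of_lt (SimpleGraph.dist_le p) hp.length_lt

/-- A tree having the same ball as a finite tree, of radius at least its size, is isomorphic to
it. -/
theorem BallIso.iso_of_finite {T S : RootedFamilyTree 1} [Finite T.V]
    (h : T.BallIso S (Nat.card T.V)) : T.Iso S := by
  obtain ⟨e, h1, h2, h3⟩ := h
  have hT : ∀ v, v ∈ T.ball (Nat.card T.V) := fun v => ⟨0, (T.dist_lt_card _ _).le⟩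
  let g : T.V → S.V := fun v => (e ⟨v, hT v⟩).1
  have hinj : Function.Injective g := fun u v huv =>
    congrArg Subtype.val (e.injective (Subtype.ext huv))
  have hroot : ∀ i, g (T.root i) = S.root i := fun i => (h1 i ⟨T.root i, hT _⟩).mp rfl
  let φ : T.tree.graph →g S.tree.graph := ⟨g, fun {u v} huv => by
    rw [OrderedFamilyTree.graph, SimpleGraph.fromRel_adj] at huv ⊢
    exact ⟨hinj.ne huv.1, huv.2.imp (h2 ⟨u, hT u⟩ ⟨v, hT v⟩).mp (h2 ⟨v, hT v⟩ ⟨u, hT u⟩).mp⟩⟩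
  -- A vertex of `T` is at distance less than |V| from the root, so a neighbour of its image is at
  -- distance at most |V| and still in the ball. Hence the image of `g` is closed under adjacency,
  -- and it is all of `S` by connectedness.
  have hstep : ∀ (v : T.V) (w : S.V), S.tree.graph.Adj (g v) w → ∃ v', g v' = w := by
    intro v w hw
    obtain ⟨p, hp⟩ := (T.tree.graph_preconnected (T.root 0) v).exists_walk_length_eq_dist
    have hd : S.tree.graph.dist (g (T.root 0)) w ≤ Nat.card T.V := by
      refine (SimpleGraph.dist_le ((p.map φ).concat hw)).trans ?_
      rw [SimpleGraph.Walk.length_concat, SimpleGraph.Walk.length_map, hp]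
      exact T.dist_lt_card _ _
    rw [hroot] at hd
    obtain ⟨v', hv'⟩ := e.surjective ⟨w, 0, hd⟩
    exact ⟨v'.1, congrArg Subtype.val hv'⟩
  have hsurj : Function.Surjective g := by
    intro w
    obtain ⟨p⟩ := S.tree.graph_preconnected (g (T.root 0)) w
    have key : ∀ (a b : S.V) (_ : S.tree.graph.Walk a b), (∃ v, g v = a) → ∃ v, g v = b := by
      intro a b q
      induction q with
      | nil => exact id
      | cons hadj _ ih =>
        rintro ⟨v, rfl⟩
        exact ih (hstep v _ hadj)
    exact key _ _ p ⟨_, rfl⟩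
  exact ⟨Equiv.ofBijective g ⟨hinj, hsurj⟩, hroot, fun u v => h2 ⟨u, hT u⟩ ⟨v, hT v⟩,
    fun u v => h3 ⟨u, hT u⟩ ⟨v, hT v⟩⟩

end RootedFamilyTree

/-- The cylinder whose radius is the size of the tree contains no other class. -/
theorem FamilyTreeSpace.isOpen_singleton_mk (T : RootedFamilyTree 1) [Finite T.V] :
    IsOpen {FamilyTreeSpace.mk T} := by
  have h : {FamilyTreeSpace.mk T} = FamilyTreeSpace.cylinder T (Nat.card T.V) := by
    ext y
    constructor
    · rintro rfl
      exact ⟨T, rfl, .refl _ _⟩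
    · rintro ⟨S, rfl, hS⟩
      exact (Quotient.sound hS.iso_of_finite : FamilyTreeSpace.mk T = FamilyTreeSpace.mk S).symm
  rw [h]
  exact TopologicalSpace.isOpen_generateFrom_of_mem ⟨T, _, rfl⟩

/-! ### Measurability of the record map -/

section Measurability

theorem measurable_partialSum (n j : ℤ) : Measurable fun x : ℤ → ℤ => partialSum x n j := by
  unfold partialSum
  exact Finset.measurable_sum _ fun i _ => measurable_pi_apply i

theorem measurableSet_partialSum_lt (n j : ℤ) :
    MeasurableSet {x : ℤ → ℤ | partialSum x n j < 0} :=
  measurableSet_lt (measurable_partialSum n j) measurable_const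

theorem measurableSet_driftsDown : MeasurableSet {x : ℤ → ℤ | DriftsDown x} := by
  have h : {x : ℤ → ℤ | DriftsDown x} =
      (⋂ n, {x | -1 ≤ x n}) ∩ (⋂ n, ⋃ J, ⋂ j, ⋂ (_ : J ≤ j), {x | partialSum x n j < 0}) ∩
        ⋂ n, ⋃ L, ⋂ v, ⋂ (_ : v ≤ L), {x | partialSum x v n < 0} := by
    ext x
    simp only [Set.mem_inter_iff, Set.mem_iInter, Set.mem_iUnion, Set.mem_ofPred_eq]
    exact ⟨fun h => ⟨⟨h.1, h.2⟩, h.3⟩, fun h => ⟨h.1.1, h.1.2, h.2⟩⟩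
  rw [h]
  refine ((MeasurableSet.iInter fun n => measurableSet_le measurable_const
    (measurable_pi_apply n)).inter ?_).inter ?_
  · exact MeasurableSet.iInter fun n => MeasurableSet.iUnion fun J => MeasurableSet.iInter fun j =>
      MeasurableSet.iInter fun _ => measurableSet_partialSum_lt n j
  · exact MeasurableSet.iInter fun n => MeasurableSet.iUnion fun J => MeasurableSet.iInter fun j =>
      MeasurableSet.iInter fun _ => measurableSet_partialSum_lt j n

theorem measurable_recordMap (n : ℤ) : Measurable fun x : ℤ → ℤ => recordMap x n := by
  refine measurable_to_countable' fun i => ?_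
  rcases lt_trichotomy i n with h | h | h
  · convert MeasurableSet.empty
    refine Set.eq_empty_of_forall_notMem fun x hx => ?_
    have h1 : recordMap x n = i := hx
    have := le_recordMap (x := x) n
    omega
  · subst h
    have h : (fun x : ℤ → ℤ => recordMap x i) ⁻¹' {i} =
        ⋂ j, ⋂ (_ : i < j), {x | partialSum x i j < 0} := by
      ext x
      simp only [Set.mem_preimage, Set.mem_singleton_iff, Set.mem_iInter, Set.mem_ofPred_eq]
      exact recordMap_eq_self_iff
    rw [h]
    exact MeasurableSet.iInter fun j => MeasurableSet.iInter fun _ =>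
      measurableSet_partialSum_lt i j
  · have h : (fun x : ℤ → ℤ => recordMap x n) ⁻¹' {i} =
        {x | 0 ≤ partialSum x n i} ∩
          ⋂ j, ⋂ (_ : n < j), ⋂ (_ : j < i), {x | partialSum x n j < 0} := by
      ext x
      simp only [Set.mem_preimage, Set.mem_singleton_iff, Set.mem_iInter, Set.mem_ofPred_eq,
        Set.mem_inter_iff]
      refine ⟨?_, fun hx => recordMap_eq h hx.1 hx.2⟩
      rintro rfl
      exact (recordMap_spec h.ne').2
    rw [h]
    exact (measurableSet_le measurable_const (measurable_partialSum n i)).inter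
      (MeasurableSet.iInter fun j => MeasurableSet.iInter fun _ => MeasurableSet.iInter fun _ =>
        measurableSet_partialSum_lt n j)

theorem measurable_iterate_recordMap (k : ℕ) (n : ℤ) :
    Measurable fun x : ℤ → ℤ => (recordMap x)^[k] n := by
  induction k with
  | zero => exact measurable_const
  | succ k ih =>
    refine measurable_to_countable' fun i => ?_
    -- The last record map is evaluated at a random point, so split over the countably many values
    -- of that point.
    have h : (fun x : ℤ → ℤ => (recordMap x)^[k + 1] n) ⁻¹' {i} =
        ⋃ j, {x | (recordMap x)^[k] n = j} ∩ {x | recordMap x j = i} := by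
      ext x
      simp only [Set.mem_preimage, Set.mem_singleton_iff, Set.mem_iUnion, Set.mem_ofPred_eq,
        Set.mem_inter_iff, Function.iterate_succ_apply', exists_eq_left']
    rw [h]
    exact MeasurableSet.iUnion fun j => (measurableSet_eq_fun ih measurable_const).inter
      (measurableSet_eq_fun (measurable_recordMap j) measurable_const)

theorem measurableSet_mem_recordGraph (p : ℤ × ℤ) :
    MeasurableSet {x : ℤ → ℤ | p ∈ recordGraph x} := by
  have h : {x : ℤ → ℤ | p ∈ recordGraph x} =
      (⋃ m : ℕ, ⋃ n : ℕ, {x | (recordMap x)^[m] p.1 = (recordMap x)^[n] 0}) ∩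
        {x | recordMap x p.1 = p.2} := by
    ext x
    simp only [Set.mem_iUnion, Set.mem_ofPred_eq, Set.mem_inter_iff]
    rfl
  rw [h]
  exact (MeasurableSet.iUnion fun m => MeasurableSet.iUnion fun n => measurableSet_eq_fun
    (measurable_iterate_recordMap m _) (measurable_iterate_recordMap n _)).inter
      (measurableSet_eq_fun (measurable_recordMap _) measurable_const)

/-- The sequences drifting to `-∞` with a given record map on the component of `0`. -/
def recordGraphFiber (s : Finset (ℤ × ℤ)) : Set (ℤ → ℤ) :=
  {x | DriftsDown x ∧ recordGraph x = s}

theorem measurableSet_recordGraphFiber (s : Finset (ℤ × ℤ)) :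
    MeasurableSet (recordGraphFiber s) := by
  have h : recordGraphFiber s = {x | DriftsDown x} ∩
      ((⋂ p, ⋂ (_ : p ∈ s), {x | p ∈ recordGraph x}) ∩
        ⋂ p, ⋂ (_ : p ∉ s), {x | p ∈ recordGraph x}ᶜ) := by
    ext x
    simp only [recordGraphFiber, Set.mem_iInter, Set.mem_ofPred_eq, Set.mem_inter_iff,
      Set.mem_compl_iff, Set.ext_iff, Finset.mem_coe]
    refine and_congr_right fun _ => ⟨fun h => ⟨fun p => (h p).mpr, fun p => mt (h p).mp⟩,
      fun h p => ⟨fun h1 => ?_, h.1 p⟩⟩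
    by_contra h2
    exact h.2 p h2 h1
  rw [h]
  exact measurableSet_driftsDown.inter
    ((MeasurableSet.iInter fun p => MeasurableSet.iInter fun _ =>
      measurableSet_mem_recordGraph p).inter
    (MeasurableSet.iInter fun p => MeasurableSet.iInter fun _ =>
      (measurableSet_mem_recordGraph p).compl))

theorem pairwise_disjoint_recordGraphFiber :
    Pairwise (Function.onFun Disjoint recordGraphFiber) := by
  intro s t hst
  refine Set.disjoint_left.mpr fun x h h' => hst ?_
  exact Finset.coe_injective (h.2.symm.trans h'.2)

theorem DriftsDown.mem_iUnion_recordGraphFiber {x : ℤ → ℤ} (hx : DriftsDown x) :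
    x ∈ ⋃ s, recordGraphFiber s := by
  rw [Set.mem_iUnion]
  exact ⟨hx.finite_recordGraph.toFinset, hx, (Set.Finite.coe_toFinset _).symm⟩

/-- Almost surely the record graph on the component is a finite subset of ℤ × ℤ, and there are
countably many of these. -/
theorem aemeasurable_of_recordGraph {β : Type*} [MeasurableSpace β] {Q : Measure (ℤ → ℤ)}
    (hQ : ∀ᵐ x ∂Q, DriftsDown x) {f : (ℤ → ℤ) → β}
    (hf : ∀ x x', recordGraph x = recordGraph x' → f x = f x') : AEMeasurable f Q :=
  aemeasurable_of_const_on (hQ.mono fun _ h => h.mem_iUnion_recordGraphFiber)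
    measurableSet_recordGraphFiber fun _ x h x' h' => hf x x' (h.2.trans h'.2.symm)

end Measurability

/-! ### Translations -/

/-- Translation of sequences. -/
def shiftSeq (k : ℤ) (x : ℤ → ℤ) : ℤ → ℤ := fun n => x (n + k)

section ShiftSeq

variable {x : ℤ → ℤ}

theorem measurable_shiftSeq (k : ℤ) : Measurable (shiftSeq k) :=
  measurable_pi_lambda _ fun n => measurable_pi_apply (n + k)

theorem partialSum_shiftSeq (k n j : ℤ) :
    partialSum (shiftSeq k x) n j = partialSum x (n + k) (j + k) := by
  unfold partialSum shiftSeq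
  exact Finset.sum_Ico_add' x n j k

theorem recordMap_shiftSeq (k n : ℤ) :
    recordMap (shiftSeq k x) n = recordMap x (n + k) - k := by
  by_cases h : recordMap x (n + k) = n + k
  · rw [h, add_sub_cancel_right, recordMap_eq_self_iff]
    intro j hj
    rw [partialSum_shiftSeq]
    exact recordMap_eq_self_iff.mp h _ (by omega)
  · obtain ⟨h1, h2, h3⟩ := recordMap_spec h
    refine recordMap_eq (by omega) ?_ fun j hj hj' => ?_
    · rw [partialSum_shiftSeq, sub_add_cancel]
      exact h2
    · rw [partialSum_shiftSeq]
      exact h3 _ (by omega) (by omega)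

theorem iterate_recordMap_shiftSeq (k : ℤ) (m : ℕ) (n : ℤ) :
    (recordMap (shiftSeq k x))^[m] n = (recordMap x)^[m] (n + k) - k := by
  induction m generalizing n with
  | zero => simp
  | succ m ih =>
    rw [Function.iterate_succ_apply, Function.iterate_succ_apply, ih, recordMap_shiftSeq,
      sub_add_cancel]

theorem mem_recordComponentSet_shiftSeq {u v : ℤ} (hu : u ∈ recordComponentSet x) :
    v - u ∈ recordComponentSet (shiftSeq u x) ↔ v ∈ recordComponentSet x := by
  have h : v - u ∈ recordComponentSet (shiftSeq u x) ↔
      ∃ m n : ℕ, (recordMap x)^[m] v = (recordMap x)^[n] u := by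
    refine exists_congr fun m => exists_congr fun n => ?_
    rw [iterate_recordMap_shiftSeq, iterate_recordMap_shiftSeq, sub_add_cancel, zero_add]
    exact sub_left_inj
  rw [h]
  exact ⟨fun ⟨m, n, h⟩ => mem_recordComponentSet_of_iterate hu h,
    fun hv => exists_common_iterate hv hu⟩

theorem zero_mem_iff_shiftSeq {u : ℤ} :
    -u ∈ recordComponentSet (shiftSeq u x) ↔ u ∈ recordComponentSet x := by
  constructor
  · rintro ⟨m, n, h⟩
    rw [iterate_recordMap_shiftSeq, iterate_recordMap_shiftSeq, neg_add_cancel, zero_add] at h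
    exact ⟨n, m, (sub_left_inj.mp h).symm⟩
  · intro h
    rw [← zero_sub, mem_recordComponentSet_shiftSeq h]
    exact zero_mem_recordComponentSet

/-- Translation moves the component to the component of the translated sequence. -/
theorem RecordComponent.mk_shiftSeq {k : ℕ} {u : ℤ} (hu : u ∈ recordComponentSet x)
    (r : Fin k → RecordComponent x) (r' : Fin k → RecordComponent (shiftSeq u x))
    (hr : ∀ i, (r' i).1 = (r i).1 - u) :
    FamilyTreeSpace.mk ⟨RecordComponent x, tree x, r⟩ =
      FamilyTreeSpace.mk ⟨RecordComponent (shiftSeq u x), tree (shiftSeq u x), r'⟩ := by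
  let e : RecordComponent x ≃ RecordComponent (shiftSeq u x) :=
    (Equiv.subRight u).subtypeEquiv fun v => (mem_recordComponentSet_shiftSeq hu).symm
  have he : ∀ v, (e v).1 = v.1 - u := fun v => rfl
  have hp : ∀ v w : RecordComponent x, parent x v = some w ↔
      parent (shiftSeq u x) (e v) = some (e w) := by
    intro v w
    rw [parent_eq_some_iff, parent_eq_some_iff, he, he, recordMap_shiftSeq, sub_add_cancel]
    exact and_congr sub_left_inj.symm (not_congr sub_left_inj.symm)
  refine Quotient.sound ⟨e, fun i => Subtype.ext (hr i).symm, hp, fun v w => ?_⟩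
  refine and_congr ⟨?_, ?_⟩ ?_
  · rintro ⟨p, h1, h2⟩
    exact ⟨e p, (hp _ _).mp h1, (hp _ _).mp h2⟩
  · rintro ⟨p, h1, h2⟩
    obtain ⟨q, rfl⟩ := e.surjective p
    exact ⟨q, (hp _ _).mpr h1, (hp _ _).mpr h2⟩
  · rw [he, he, sub_lt_sub_iff_right]

/-- Translation permutes the indices of a product of identical factors. -/
theorem map_shiftSeq_infinitePi (ρ : Measure ℤ) [IsProbabilityMeasure ρ] (k : ℤ) :
    (Measure.infinitePi fun _ : ℤ => ρ).map (shiftSeq k) = Measure.infinitePi fun _ : ℤ => ρ := by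
  have h := Measure.infinitePi_map_piCongrLeft (fun _ : ℤ => ρ) (Equiv.subRight k)
  convert h using 2
  ext x n
  obtain ⟨m, rfl⟩ := (Equiv.subRight k).surjective n
  rw [MeasurableEquiv.coe_piCongrLeft, Equiv.piCongrLeft_apply_apply]
  simp [shiftSeq]

end ShiftSeq

/-! ### The mass transport principle -/

namespace FamilyTreeSpace

open Classical in
/-- The mass sent from `0` to `u`. -/
noncomputable def massTo (f : FamilyTreeSpace 2 → ℝ≥0∞) (u : ℤ) (x : ℤ → ℤ) : ℝ≥0∞ :=
  if h : u ∈ recordComponentSet x then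
    f (mk ⟨RecordComponent x, RecordComponent.tree x, ![⟨0, 0, 0, rfl⟩, ⟨u, h⟩]⟩) else 0

open Classical in
/-- The mass received by `0` from `u`. -/
noncomputable def massFrom (f : FamilyTreeSpace 2 → ℝ≥0∞) (u : ℤ) (x : ℤ → ℤ) : ℝ≥0∞ :=
  if h : u ∈ recordComponentSet x then
    f (mk ⟨RecordComponent x, RecordComponent.tree x, ![⟨u, h⟩, ⟨0, 0, 0, rfl⟩]⟩) else 0

variable (f : FamilyTreeSpace 2 → ℝ≥0∞)

theorem massOut_rooted (x : ℤ → ℤ) :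
    massOut f (mk (RecordComponent.rooted x)) = ∑' u, massTo f u x := by
  rw [← tsum_subtype_eq_of_support_subset (s := recordComponentSet x)]
  · refine tsum_congr fun (u : RecordComponent x) => ?_
    have h : massTo f u.1 x = f (mk ⟨RecordComponent x, RecordComponent.tree x,
      ![⟨0, 0, 0, rfl⟩, u]⟩) := dif_pos u.2
    exact h.symm
  · intro u hu
    by_contra h
    exact hu (dif_neg h)

theorem massIn_rooted (x : ℤ → ℤ) :
    massIn f (mk (RecordComponent.rooted x)) = ∑' u, massFrom f u x := by
  rw [← tsum_subtype_eq_of_support_subset (s := recordComponentSet x)]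
  · refine tsum_congr fun (u : RecordComponent x) => ?_
    have h : massFrom f u.1 x = f (mk ⟨RecordComponent x, RecordComponent.tree x,
      ![u, ⟨0, 0, 0, rfl⟩]⟩) := dif_pos u.2
    exact h.symm
  · intro u hu
    by_contra h
    exact hu (dif_neg h)

theorem massTo_congr {x x' : ℤ → ℤ} (h : recordGraph x = recordGraph x') (u : ℤ) :
    massTo f u x = massTo f u x' := by
  unfold massTo
  have hs := recordComponentSet_eq_of_recordGraph_eq h
  by_cases hu : u ∈ recordComponentSet x
  · rw [dif_pos hu, dif_pos (hs ▸ hu)]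
    refine congrArg f (RecordComponent.mk_eq_of_recordGraph_eq h _ _ fun i => ?_)
    fin_cases i <;> rfl
  · rw [dif_neg hu, dif_neg (hs ▸ hu)]

theorem massFrom_congr {x x' : ℤ → ℤ} (h : recordGraph x = recordGraph x') (u : ℤ) :
    massFrom f u x = massFrom f u x' := by
  unfold massFrom
  have hs := recordComponentSet_eq_of_recordGraph_eq h
  by_cases hu : u ∈ recordComponentSet x
  · rw [dif_pos hu, dif_pos (hs ▸ hu)]
    refine congrArg f (RecordComponent.mk_eq_of_recordGraph_eq h _ _ fun i => ?_)
    fin_cases i <;> rfl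
  · rw [dif_neg hu, dif_neg (hs ▸ hu)]

/-- Translation by u carries the component with roots (0,u) to the component of the translated
sequence with roots (-u,0). -/
theorem massTo_eq_massFrom_shiftSeq (u : ℤ) (x : ℤ → ℤ) :
    massTo f u x = massFrom f (-u) (shiftSeq u x) := by
  unfold massTo massFrom
  by_cases hu : u ∈ recordComponentSet x
  · rw [dif_pos hu, dif_pos (zero_mem_iff_shiftSeq.mpr hu)]
    refine congrArg f (RecordComponent.mk_shiftSeq hu _ _ fun i => ?_)
    fin_cases i
    · simp
    · simp
  · rw [dif_neg hu, dif_neg (mt zero_mem_iff_shiftSeq.mp hu)]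

variable {Q : Measure (ℤ → ℤ)}

theorem lintegral_massTo_eq_massFrom (hQ : ∀ᵐ x ∂Q, DriftsDown x)
    (hinv : ∀ k, Q.map (shiftSeq k) = Q) :
    ∫⁻ x, ∑' u, massTo f u x ∂Q = ∫⁻ x, ∑' u, massFrom f u x ∂Q := by
  have h1 : ∀ u, AEMeasurable (massTo f u) Q := fun u =>
    aemeasurable_of_recordGraph hQ fun x x' h => massTo_congr f h u
  have h2 : ∀ u, AEMeasurable (massFrom f u) Q := fun u =>
    aemeasurable_of_recordGraph hQ fun x x' h => massFrom_congr f h u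
  rw [lintegral_tsum h1, lintegral_tsum h2, ← (Equiv.neg ℤ).tsum_eq]
  refine tsum_congr fun u => ?_
  rw [Equiv.neg_apply]
  simp_rw [massTo_eq_massFrom_shiftSeq f (-u), neg_neg]
  rw [← lintegral_map' (f := massFrom f u) (by rw [hinv]; exact h2 u)
    (measurable_shiftSeq (-u)).aemeasurable, hinv]

theorem isUnimodular_map_rooted (hQ : ∀ᵐ x ∂Q, DriftsDown x)
    (hinv : ∀ k, Q.map (shiftSeq k) = Q) :
    IsUnimodular (Q.map fun x => mk (RecordComponent.rooted x)) := by
  intro f _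
  have hφ : AEMeasurable (fun x => mk (RecordComponent.rooted x)) Q :=
    aemeasurable_of_recordGraph hQ fun x x' h =>
      RecordComponent.mk_eq_of_recordGraph_eq h _ _ fun _ => rfl
  -- The law is carried by the classes of one representative per nonempty fibre. These are countably
  -- many isolated points, so every function is almost everywhere measurable.
  let A : {s : Finset (ℤ × ℤ) // (recordGraphFiber s).Nonempty} → Set (FamilyTreeSpace 1) :=
    fun s => {mk (RecordComponent.rooted s.2.choose)}
  have hA : ∀ s, MeasurableSet (A s) := by
    intro s
    have : Finite (RecordComponent.rooted s.2.choose).V :=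
      s.2.choose_spec.1.finite_recordComponentSet
    exact (isOpen_singleton_mk _).measurableSet
  have hcover : ∀ᵐ y ∂(Q.map fun x => mk (RecordComponent.rooted x)), y ∈ ⋃ s, A s := by
    refine (ae_map_iff hφ (p := fun y => y ∈ ⋃ s, A s) (MeasurableSet.iUnion hA)).mpr ?_
    filter_upwards [hQ] with x hx
    obtain ⟨s, hs⟩ := Set.mem_iUnion.mp hx.mem_iUnion_recordGraphFiber
    refine Set.mem_iUnion.mpr ⟨⟨s, x, hs⟩, ?_⟩
    refine RecordComponent.mk_eq_of_recordGraph_eq ?_ _ _ fun _ => rfl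
    exact hs.2.trans (Exists.choose_spec (⟨x, hs⟩ : (recordGraphFiber s).Nonempty)).2.symm
  have hm : ∀ g : FamilyTreeSpace 1 → ℝ≥0∞,
      AEMeasurable g (Q.map fun x => mk (RecordComponent.rooted x)) := fun g =>
    aemeasurable_of_const_on hcover hA fun s y hy y' hy' => by
      rw [Set.mem_singleton_iff.mp hy, Set.mem_singleton_iff.mp hy']
  rw [lintegral_map' (hm _) hφ, lintegral_map' (hm _) hφ]
  simp_rw [massOut_rooted, massIn_rooted]
  exact lintegral_massTo_eq_massFrom f hQ hinv

end FamilyTreeSpace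

/-! ### Independent increments -/

theorem lintegral_offspring {ρ : Measure ℤ} {π : PMF ℕ}
    (hπ : ∀ n : ℕ, ρ {k | k + 1 = n} = π n) :
    ∫⁻ k : ℤ, ((k + 1).toNat : ℝ≥0∞) ∂ρ = TGWT.mean π := by
  have hm : Measurable fun k : ℤ => (k + 1).toNat := measurable_from_top
  rw [← lintegral_map (f := fun n : ℕ => (n : ℝ≥0∞)) measurable_from_top hm,
    lintegral_countable', TGWT.mean]
  refine tsum_congr fun n => ?_
  -- `toNat` sends every k ≤ -1 to 0, but the term of index 0 has weight zero.
  rcases n with _ | n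
  · simp
  · rw [Measure.map_apply hm (measurableSet_singleton _), ← hπ]
    congr 2
    ext k
    simp only [Set.mem_preimage, Set.mem_singleton_iff, Set.mem_ofPred_eq]
    omega

section Increments

variable {ρ : Measure ℤ} [IsProbabilityMeasure ρ]

theorem identDistrib_eval_infinitePi (i j : ℤ) :
    IdentDistrib (fun x : ℤ → ℤ => x i) (fun x => x j) (Measure.infinitePi fun _ : ℤ => ρ)
      (Measure.infinitePi fun _ : ℤ => ρ) :=
  ⟨(measurable_pi_apply i).aemeasurable, (measurable_pi_apply j).aemeasurable, by
    rw [Measure.infinitePi_map_eval, Measure.infinitePi_map_eval]⟩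

/-- Partial sums of increments of negative mean are eventually negative. -/
theorem ae_exists_sum_range_neg (hint : Integrable (fun k : ℤ => (k : ℝ)) ρ)
    (hneg : ∫ k, (k : ℝ) ∂ρ < 0) {g : ℕ → ℤ} (hg : Function.Injective g) :
    ∀ᵐ x ∂(Measure.infinitePi fun _ : ℤ => ρ), ∃ K : ℕ, ∀ k, K ≤ k →
      ∑ i ∈ Finset.range k, x (g i) < 0 := by
  set Q := Measure.infinitePi fun _ : ℤ => ρ with hQ
  have hmp : ∀ i : ℤ, MeasurePreserving (Function.eval i) Q ρ := fun i =>
    measurePreserving_eval_infinitePi _ i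
  have hind : iIndepFun (fun (i : ℤ) (x : ℤ → ℤ) => (x i : ℝ)) Q :=
    iIndepFun_infinitePi (P := fun _ : ℤ => ρ) (X := fun _ (k : ℤ) => (k : ℝ))
      fun _ => measurable_from_top
  have hcast : Measurable fun k : ℤ => (k : ℝ) := measurable_from_top
  have h := strong_law_ae_real (μ := Q) (fun n x => (x (g n) : ℝ))
    ((hmp (g 0)).integrable_comp_of_integrable hint)
    (fun i j hij => hind.indepFun (hg.ne hij))
    fun i => (identDistrib_eval_infinitePi (g i) (g 0)).comp hcast
  have hmean : ∫ x, (x (g 0) : ℝ) ∂Q = ∫ k, (k : ℝ) ∂ρ := by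
    rw [← (hmp (g 0)).map_eq]
    exact (integral_map (measurable_pi_apply (g 0)).aemeasurable
      hcast.aestronglyMeasurable).symm
  filter_upwards [h] with x hx
  rw [hmean] at hx
  -- The averages converge to a negative mean, and a negative average has a negative sum.
  obtain ⟨K, hK⟩ := Filter.eventually_atTop.mp (hx.eventually_lt_const hneg)
  refine ⟨K, fun k hk => ?_⟩
  have h1 := hK k hk
  by_contra hc
  refine absurd h1 (not_lt.mpr (div_nonneg ?_ (Nat.cast_nonneg k)))
  exact_mod_cast not_lt.mp hc

theorem partialSum_add_natCast (x : ℤ → ℤ) (n : ℤ) (k : ℕ) :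
    partialSum x n (n + k) = ∑ i ∈ Finset.range k, x (n + i) := by
  induction k with
  | zero => simp [partialSum_self]
  | succ k ih =>
    rw [Finset.sum_range_succ, ← ih,
      ← partialSum_add x (show n ≤ n + k by omega) (show n + k ≤ n + (k + 1 : ℕ) by omega)]
    have := partialSum_pred (x := x) (n + k + 1)
    simp only [add_sub_cancel_right] at this
    push_cast
    rw [← add_assoc, this]

theorem partialSum_sub_natCast (x : ℤ → ℤ) (n : ℤ) (k : ℕ) :
    partialSum x (n - k) n = ∑ i ∈ Finset.range k, x (n - 1 - i) := by
  induction k with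
  | zero => simp [partialSum_self]
  | succ k ih =>
    rw [Finset.sum_range_succ, ← ih, partialSum_succ_left (by omega), add_comm]
    congr 2 <;> push_cast <;> ring

theorem ae_driftsDown (hge : ∀ᵐ k ∂ρ, -1 ≤ k) (hint : Integrable (fun k : ℤ => (k : ℝ)) ρ)
    (hneg : ∫ k, (k : ℝ) ∂ρ < 0) :
    ∀ᵐ x ∂(Measure.infinitePi fun _ : ℤ => ρ), DriftsDown x := by
  have h1 : ∀ᵐ x ∂(Measure.infinitePi fun _ : ℤ => ρ), ∀ n, -1 ≤ x n := by
    rw [ae_all_iff]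
    exact fun n => (measurePreserving_eval_infinitePi _ n).quasiMeasurePreserving.ae hge
  have h2 : ∀ᵐ x ∂(Measure.infinitePi fun _ : ℤ => ρ), ∀ n : ℤ, ∃ K : ℕ, ∀ k, K ≤ k →
      ∑ i ∈ Finset.range k, x (n + i) < 0 := by
    rw [ae_all_iff]
    exact fun n => ae_exists_sum_range_neg hint hneg (g := fun i => n + i)
      fun i j h => by simpa using h
  have h3 : ∀ᵐ x ∂(Measure.infinitePi fun _ : ℤ => ρ), ∀ n : ℤ, ∃ K : ℕ, ∀ k, K ≤ k →
      ∑ i ∈ Finset.range k, x (n - 1 - i) < 0 := by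
    rw [ae_all_iff]
    exact fun n => ae_exists_sum_range_neg hint hneg (g := fun i => n - 1 - i)
      fun i j h => by simpa using h
  filter_upwards [h1, h2, h3] with x h1 h2 h3
  refine ⟨h1, fun n => ?_, fun n => ?_⟩
  · obtain ⟨K, hK⟩ := h2 n
    refine ⟨n + K, fun j hj => ?_⟩
    have h := partialSum_add_natCast x n (j - n).toNat
    rw [show n + ((j - n).toNat : ℤ) = j by omega] at h
    rw [h]
    exact hK _ (by omega)
  · obtain ⟨K, hK⟩ := h3 n
    refine ⟨n - K, fun v hv => ?_⟩
    have h := partialSum_sub_natCast x n (n - v).toNat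
    rw [show n - ((n - v).toNat : ℤ) = v by omega] at h
    rw [h]
    exact hK _ (by omega)

/-! ### The probability of a given component of 0 -/

variable {π : PMF ℕ}

theorem mean_lt_one (hge : ∀ᵐ k ∂ρ, -1 ≤ k) (hint : Integrable (fun k : ℤ => (k : ℝ)) ρ)
    (hneg : ∫ k, (k : ℝ) ∂ρ < 0) (hπ : ∀ n : ℕ, ρ {k | k + 1 = n} = π n) :
    TGWT.mean π < 1 := by
  have hae : ∀ᵐ k : ℤ ∂ρ, (0 : ℝ) ≤ (k : ℝ) + 1 := by
    filter_upwards [hge] with k hk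
    exact_mod_cast (show 0 ≤ k + 1 by omega)
  have h1 : ∫⁻ k : ℤ, ((k + 1).toNat : ℝ≥0∞) ∂ρ = ∫⁻ k : ℤ, ENNReal.ofReal ((k : ℝ) + 1) ∂ρ := by
    refine lintegral_congr_ae ?_
    filter_upwards [hge] with k hk
    rw [← ENNReal.ofReal_natCast]
    congr 1
    exact_mod_cast Int.toNat_of_nonneg (show 0 ≤ k + 1 by omega)
  have hint' : Integrable (fun k : ℤ => (k : ℝ) + 1) ρ := hint.add (integrable_const 1)
  rw [← lintegral_offspring hπ, h1, ← ofReal_integral_eq_lintegral_ofReal hint' hae,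
    integral_add hint (integrable_const 1)]
  simp only [integral_const, probReal_univ, smul_eq_mul, mul_one]
  rw [ENNReal.ofReal_lt_one]
  linarith

/-- The probability that `0` has a parent is the mean number of its children. -/
theorem measure_recordMap_ne (hQ : ∀ᵐ x ∂(Measure.infinitePi fun _ : ℤ => ρ), DriftsDown x)
    (hπ : ∀ n : ℕ, ρ {k | k + 1 = n} = π n) :
    (Measure.infinitePi fun _ : ℤ => ρ) {x | recordMap x 0 ≠ 0} = TGWT.mean π := by
  classical
  set Q := Measure.infinitePi fun _ : ℤ => ρ with hQdef
  have hmeas : ∀ u i : ℤ, MeasurableSet {x : ℤ → ℤ | recordMap x u = i ∧ u ≠ i} := by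
    intro u i
    by_cases h : u = i
    · simp [h]
    · simpa [h] using measurableSet_eq_fun (measurable_recordMap u) measurable_const
  have h1 : Q {x | recordMap x 0 ≠ 0} = ∑' i : ℤ, Q {x | recordMap x 0 = i ∧ 0 ≠ i} := by
    rw [← measure_iUnion _ (hmeas 0)]
    · congr 1
      ext x
      simp only [Set.mem_iUnion, Set.mem_ofPred_eq]
      exact ⟨fun h => ⟨_, rfl, h.symm⟩, fun ⟨i, h, h'⟩ => h ▸ h'.symm⟩
    · intro i j hij
      exact Set.disjoint_left.mpr fun x hi hj => hij (hi.1.symm.trans hj.1)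
  -- Mass transport from a vertex to its parent: after translation by u, 0 being a child of -u
  -- becomes u being a child of 0. Summing over u counts the children of 0.
  have h2 : ∀ u : ℤ, Q {x | recordMap x 0 = -u ∧ 0 ≠ -u} = Q {x | recordMap x u = 0 ∧ u ≠ 0} := by
    intro u
    conv_lhs => rw [hQdef, ← map_shiftSeq_infinitePi ρ u, ← hQdef,
      Measure.map_apply (measurable_shiftSeq u) (hmeas 0 (-u))]
    congr 1
    ext x
    simp only [Set.mem_preimage, Set.mem_ofPred_eq, recordMap_shiftSeq, zero_add]
    constructor <;> rintro ⟨h, h'⟩ <;> constructor <;> omega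
  have h3 : ∀ x, DriftsDown x →
      ∑' u : ℤ, ({x | recordMap x u = 0 ∧ u ≠ 0} : Set (ℤ → ℤ)).indicator 1 x =
        ((x (-1) + 1).toNat : ℝ≥0∞) := by
    intro x hx
    have hs : ∀ u : ℤ, ({x | recordMap x u = 0 ∧ u ≠ 0} : Set (ℤ → ℤ)).indicator 1 x =
        ({u | recordMap x u = 0 ∧ u ≠ 0} : Set ℤ).indicator (1 : ℤ → ℝ≥0∞) u := fun u => rfl
    have hfin : {u | recordMap x u = 0 ∧ u ≠ 0}.Finite :=
      (recordMap_fiber_finite x 0).subset fun u hu => ⟨hu.1, by rw [hu.1]; exact hu.2.symm⟩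
    rw [tsum_congr hs, ← tsum_subtype]
    simp only [Pi.one_apply]
    rw [ENNReal.tsum_set_one, ← hfin.cast_ncard_eq, hx.ncard_children 0]
    simp
  rw [h1, ← (Equiv.neg ℤ).tsum_eq]
  simp only [Equiv.neg_apply]
  simp_rw [h2]
  calc ∑' u, Q {x | recordMap x u = 0 ∧ u ≠ 0}
      = ∑' u, ∫⁻ x, ({x | recordMap x u = 0 ∧ u ≠ 0} : Set (ℤ → ℤ)).indicator 1 x ∂Q :=
        tsum_congr fun u => (lintegral_indicator_one (hmeas u 0)).symm
    _ = ∫⁻ x, ((x (-1) + 1).toNat : ℝ≥0∞) ∂Q := by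
        rw [← lintegral_tsum fun u => (measurable_one.indicator (hmeas u 0)).aemeasurable]
        exact lintegral_congr_ae (hQ.mono h3)
    _ = TGWT.mean π := by
        rw [← lintegral_offspring hπ, ← Measure.infinitePi_map_eval (fun _ : ℤ => ρ) (-1),
          lintegral_map measurable_from_top (measurable_pi_apply _)]

/-- The probability that `b` has no parent. -/
theorem measure_recordMap_eq_self
    (hQ : ∀ᵐ x ∂(Measure.infinitePi fun _ : ℤ => ρ), DriftsDown x)
    (hπ : ∀ n : ℕ, ρ {k | k + 1 = n} = π n) (b : ℤ) :
    (Measure.infinitePi fun _ : ℤ => ρ) {x | recordMap x b = b} = 1 - TGWT.mean π := by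
  have hmeas : MeasurableSet {x : ℤ → ℤ | recordMap x 0 = 0} :=
    measurableSet_eq_fun (measurable_recordMap 0) measurable_const
  have h1 : (Measure.infinitePi fun _ : ℤ => ρ) {x | recordMap x 0 = 0} = 1 - TGWT.mean π := by
    rw [← measure_recordMap_ne hQ hπ]
    have h := prob_compl_eq_one_sub (μ := Measure.infinitePi fun _ : ℤ => ρ) hmeas.compl
    rwa [compl_compl] at h
  rw [← h1]
  conv_rhs => rw [← map_shiftSeq_infinitePi ρ b, Measure.map_apply (measurable_shiftSeq b) hmeas]
  congr 1
  ext x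
  simp only [Set.mem_preimage, Set.mem_ofPred_eq, recordMap_shiftSeq, zero_add]
  omega

/-- Increments before `b` are independent of the event that `b` has no parent. -/
theorem measure_inter_recordMap_eq_self (b : ℤ) (s : Finset ℤ) (hs : ∀ i ∈ s, i < b)
    (y : ℤ → ℤ) :
    (Measure.infinitePi fun _ : ℤ => ρ)
        (Set.pi s (fun i => {y i}) ∩ {x | recordMap x b = b}) =
      (∏ i ∈ s, ρ {y i}) * (Measure.infinitePi fun _ : ℤ => ρ) {x | recordMap x b = b} := by
  have hind : iIndepFun (fun (i : ℤ) (x : ℤ → ℤ) => x i) (Measure.infinitePi fun _ : ℤ => ρ) :=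
    iIndepFun_infinitePi (P := fun _ : ℤ => ρ) (X := fun _ (k : ℤ) => k) fun _ => measurable_id
  let m : ℤ → MeasurableSpace (ℤ → ℤ) := fun i => MeasurableSpace.comap (fun x => x i) inferInstance
  have hdisj : Disjoint (Set.Iio b) (Set.Ici b) :=
    Set.disjoint_left.mpr fun i (hi : i < b) (hi' : b ≤ i) => absurd hi (not_lt.mpr hi')
  -- The record of b is governed by the sums y(b,j), which involve only indices from b on.
  have hI := indep_iSup_of_disjoint (m := m) (fun i => (measurable_pi_apply i).comap_le) hind hdisj
  have heval : ∀ (S : Set ℤ) (i : ℤ), i ∈ S →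
      Measurable[⨆ i ∈ S, m i] (fun x : ℤ → ℤ => x i) := fun S i hi =>
    (comap_measurable _).mono (le_iSup₂_of_le i hi le_rfl) le_rfl
  rw [(Indep_iff _ _ _).mp hI, Measure.infinitePi_pi _ fun _ _ => measurableSet_singleton _]
  · have h : (Set.pi s fun i => {y i} : Set (ℤ → ℤ)) = ⋂ i ∈ s, (fun x => x i) ⁻¹' {y i} := by
      ext x
      simp [Set.mem_pi]
    rw [h]
    exact Finset.measurableSet_biInter s fun i hi =>
      heval _ i (hs i hi) (measurableSet_singleton _)
  · have h : {x : ℤ → ℤ | recordMap x b = b} =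
        ⋂ j, ⋂ (_ : b < j), (fun x => partialSum x b j) ⁻¹' Set.Iio 0 := by
      ext x
      simp only [Set.mem_ofPred_eq, Set.mem_iInter, Set.mem_preimage, Set.mem_Iio]
      exact recordMap_eq_self_iff
    rw [h]
    refine MeasurableSet.iInter fun j => MeasurableSet.iInter fun _ => ?_
    have hm : Measurable[⨆ i ∈ Set.Ici b, m i] (fun x : ℤ → ℤ => partialSum x b j) := by
      unfold partialSum
      exact Finset.measurable_sum _ fun i hi => heval _ i (Finset.mem_Ico.mp hi).1
    exact hm measurableSet_Iio

/-- Records move to the right, so the top of the tree is the largest integer of the component. Hence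
the offspring numbers x_{v-1} of the component have indices below the top. -/
theorem RecordCode.le_iterate_height {x : ℤ → ℤ} (hx : DriftsDown x) {v : ℤ}
    (hv : v ∈ recordComponentSet x) : v ≤ (recordMap x)^[RecordCode.height x] 0 := by
  obtain ⟨m, n, h⟩ := hv
  refine (le_iterate_recordMap (x := x) m v).trans ?_
  rw [h]
  rcases le_total n (RecordCode.height x) with hn | hn
  · obtain ⟨d, hd⟩ := Nat.exists_eq_add_of_le' hn
    rw [hd, Function.iterate_add_apply]
    exact le_iterate_recordMap d _
  · exact (RecordCode.iterate_of_height_le hx hn).le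

/-- The probability of a given component of `0` is at most the product of the offspring
probabilities times the probability that the top has no parent. -/
theorem measure_recordGraphFiber_le
    (hQ : ∀ᵐ x ∂(Measure.infinitePi fun _ : ℤ => ρ), DriftsDown x)
    (hπ : ∀ n : ℕ, ρ {k | k + 1 = n} = π n) {s : Finset (ℤ × ℤ)} {x : ℤ → ℤ}
    (hx : x ∈ recordGraphFiber s) :
    (Measure.infinitePi fun _ : ℤ => ρ) (recordGraphFiber s) ≤
      (1 - TGWT.mean π) *
        ∏ v ∈ hx.1.finite_recordComponentSet.toFinset, π (x (v - 1) + 1).toNat := by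
  classical
  set C := hx.1.finite_recordComponentSet.toFinset with hC
  set b := (recordMap x)^[RecordCode.height x] 0 with hb
  have hmem : ∀ v, v ∈ C ↔ v ∈ recordComponentSet x := fun v => Set.Finite.mem_toFinset _
  have hbC : b ∈ recordComponentSet x := ⟨0, _, rfl⟩
  have hinj : Set.InjOn (fun v : ℤ => v - 1) C := fun v _ w _ h => by simpa using h
  -- The graph determines the offspring number of each vertex of the component and the fact that `b`
  -- is fixed by the record map. This inclusion alone gives the upper bound.
  have hsub : recordGraphFiber s ⊆
      Set.pi (C.image fun v => v - 1) (fun i => {x i}) ∩ {x | recordMap x b = b} := by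
    intro x' hx'
    have hG : recordGraph x = recordGraph x' := hx.2.trans hx'.2.symm
    refine ⟨?_, ?_⟩
    · intro i hi
      obtain ⟨v, hv, rfl⟩ := Finset.mem_image.mp (Finset.mem_coe.mp hi)
      exact (hx.1.apply_eq_of_recordGraph_eq hx'.1 hG ((hmem v).mp hv)).symm
    · change recordMap x' b = b
      rw [← recordMap_eq_of_recordGraph_eq hG hbC]
      exact RecordCode.iterate_height hx.1
  refine (measure_mono hsub).trans ?_
  rw [measure_inter_recordMap_eq_self, measure_recordMap_eq_self hQ hπ, mul_comm,
    Finset.prod_image hinj]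
  · refine le_of_eq ?_
    congr 1
    refine Finset.prod_congr rfl fun v _ => ?_
    rw [← hπ]
    congr 1
    have := hx.1.ge_neg_one (v - 1)
    ext k
    simp only [Set.mem_singleton_iff, Set.mem_ofPred_eq]
    omega
  · intro i hi
    obtain ⟨v, hv, rfl⟩ := Finset.mem_image.mp hi
    have := RecordCode.le_iterate_height hx.1 ((hmem v).mp hv)
    omega

end Increments

/-! ### Comparison with the Typically rooted Galton–Watson Tree -/

namespace TGWT

variable {π : PMF ℕ}

theorem mean_mul_sizeBiased (h0 : mean π ≠ 0) (h1 : mean π ≠ ∞) (n : ℕ) :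
    mean π * sizeBiased π n = n * π n := by
  have h : sizeBiased π n = n * π n * (mean π)⁻¹ := by
    rw [sizeBiased, dif_pos ⟨h0, h1⟩]
    exact PMF.normalize_apply _ _ _
  rw [h, mul_comm, mul_assoc, ENNReal.inv_mul_cancel h0 h1, mul_one]

/-- Keep only the outcome Z = s + 1 with position u; a lower bound avoids discussing that Z = 0 and
Z = 1 both give Z - 1 = 0. -/
theorem le_spineLaw_apply (π : PMF ℕ) {s u : ℕ} (hu : u ≤ s) :
    sizeBiased π (s + 1) * ((s + 1 : ℕ) : ℝ≥0∞)⁻¹ ≤ spineLaw π (s, u) := by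
  classical
  rw [spineLaw, PMF.bind_apply]
  refine le_trans (mul_le_mul' ?_ ?_) (ENNReal.le_tsum s)
  · rw [PMF.map_apply]
    refine le_trans ?_ (ENNReal.le_tsum (s + 1))
    simp
  · rw [PMF.map_apply]
    refine le_trans ?_ (ENNReal.le_tsum u)
    rw [if_pos rfl, PMF.uniformOfFinset_apply_of_mem _ (Finset.mem_range.mpr (by omega)),
      Finset.card_range]

/-- The factor s + 1 of size-biasing cancels against the uniform choice among s + 1 positions, and
the factor m against the normalization. If m = 0, then π vanishes on positive integers. -/
theorem le_mean_mul_spineLaw (h1 : mean π ≠ ∞) {s u : ℕ} (hu : u ≤ s) :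
    π (s + 1) ≤ mean π * spineLaw π (s, u) := by
  by_cases h0 : mean π = 0
  · have h := ENNReal.tsum_eq_zero.mp h0 (s + 1)
    have h2 : π (s + 1) = 0 := by simpa using h
    rw [h2]
    exact zero_le
  · refine le_trans (le_of_eq ?_) (mul_le_mul_right (le_spineLaw_apply π hu) (mean π))
    rw [← mul_assoc, mean_mul_sizeBiased h0 h1, mul_comm, ← mul_assoc,
      ENNReal.inv_mul_cancel (by simp) (by finiteness), one_mul]

/-- The law of the data from which the tree is built. -/
noncomputable def dataLaw (π : PMF ℕ) (hπ : mean π < 1) :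
    Measure (ℕ × (ℕ → ℕ × ℕ) × (ℕ × List ℕ → ℕ)) :=
  (ancestorLaw (mean π) hπ).toMeasure.prod
    ((Measure.infinitePi fun _ : ℕ => (spineLaw π).toMeasure).prod
      (Measure.infinitePi fun _ : ℕ × List ℕ => π.toMeasure))

instance (hπ : mean π < 1) : IsProbabilityMeasure (dataLaw π hπ) := by
  unfold dataLaw
  infer_instance

end TGWT

namespace RecordCode

variable {x : ℤ → ℤ}

theorem finite_isVertex (hx : DriftsDown x) :
    {p : ℕ × List ℕ | TGWT.IsVertex (height x) (spine x) (offspring x) p.1 p.2}.Finite := by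
  have : Finite (RecordComponent x) := hx.finite_recordComponentSet
  exact Finite.of_equiv _ (compatible_self.vertexEquiv hx).symm

/-- The codes of the component of `0`. -/
noncomputable def codes (hx : DriftsDown x) : Finset (ℕ × List ℕ) := (finite_isVertex hx).toFinset

theorem mem_codes {hx : DriftsDown x} {p : ℕ × List ℕ} :
    p ∈ codes hx ↔ TGWT.IsVertex (height x) (spine x) (offspring x) p.1 p.2 :=
  Set.Finite.mem_toFinset _

open Classical in
/-- The codes of the vertices that are not ancestors of the root. -/
noncomputable def bushCodes (hx : DriftsDown x) : Finset (ℕ × List ℕ) :=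
  (codes hx).filter fun p => p = (0, []) ∨ p.2 ≠ []

/-- The data that agree with the canonical data of the component of `0` on its codes. -/
def agreeSet (hx : DriftsDown x) : Set (ℕ × (ℕ → ℕ × ℕ) × (ℕ × List ℕ → ℕ)) :=
  {height x} ×ˢ ((Finset.range (height x) : Set ℕ).pi (fun i => {spine x i}) ×ˢ
    (bushCodes hx : Set (ℕ × List ℕ)).pi fun p => {offspring x p})

theorem measurableSet_agreeSet (hx : DriftsDown x) : MeasurableSet (agreeSet hx) :=
  (measurableSet_singleton _).prod
    ((MeasurableSet.pi (Finset.countable_toSet _) fun _ _ => measurableSet_singleton _).prod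
      (MeasurableSet.pi (Finset.countable_toSet _) fun _ _ => measurableSet_singleton _))

theorem compatible_of_mem_agreeSet (hx : DriftsDown x)
    {d : ℕ × (ℕ → ℕ × ℕ) × (ℕ × List ℕ → ℕ)} (hd : d ∈ agreeSet hx) :
    Compatible x d.1 d.2.1 d.2.2 := by
  classical
  obtain ⟨N, sp, ξ⟩ := d
  obtain ⟨hN, hsp, hξ⟩ := hd
  have h1 : N = height x := hN
  subst h1
  refine compatible_of_agree (fun i hi => hsp i (by simpa using hi)) (hξ _ ?_)
    fun i j w h => hξ _ ?_
  · exact Finset.mem_coe.mpr (Finset.mem_filter.mpr ⟨mem_codes.mpr (Nat.zero_le _), Or.inl rfl⟩)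
  · exact Finset.mem_coe.mpr (Finset.mem_filter.mpr ⟨mem_codes.mpr h, Or.inr (by simp)⟩)

theorem prod_component_eq_prod_codes (hx : DriftsDown x) (π : ℕ → ℝ≥0∞) :
    ∏ v ∈ hx.finite_recordComponentSet.toFinset, π (x (v - 1) + 1).toNat =
      ∏ p ∈ codes hx, π (offspring x p) := by
  symm
  refine Finset.prod_bij (fun p _ => decode x p.1 p.2) (fun p hp => ?_) (fun p hp q hq h => ?_)
    (fun v hv => ?_) fun p _ => rfl
  · exact (Set.Finite.mem_toFinset _).mpr (compatible_self.decode_mem hx ⟨p, mem_codes.mp hp⟩)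
  · exact congrArg Subtype.val (compatible_self.decode_injective hx
      (u := ⟨p, mem_codes.mp hp⟩) (v := ⟨q, mem_codes.mp hq⟩) h)
  · obtain ⟨u, hu⟩ := compatible_self.exists_decode_eq hx ((Set.Finite.mem_toFinset _).mp hv)
    exact ⟨u.1, mem_codes.mpr u.2, hu⟩

theorem prod_codes_eq (hx : DriftsDown x) (F : ℕ × List ℕ → ℝ≥0∞) :
    ∏ p ∈ codes hx, F p =
      (∏ p ∈ bushCodes hx, F p) * ∏ i ∈ Finset.range (height x), F (i + 1, []) := by
  classical
  -- The codes outside `bushCodes` are those of the proper ancestors of the root, whose offspring is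
  -- recorded by the spine.
  rw [← Finset.prod_filter_mul_prod_filter_not (codes hx) fun p => p = (0, []) ∨ p.2 ≠ []]
  congr 1
  have h : (codes hx).filter (fun p => ¬ (p = (0, []) ∨ p.2 ≠ [])) =
      (Finset.range (height x)).image fun i => (i + 1, []) := by
    ext ⟨i, w⟩
    simp only [Finset.mem_filter, mem_codes, Finset.mem_image, Finset.mem_range]
    constructor
    · rintro ⟨h1, h2⟩
      push Not at h2
      obtain ⟨h2, h3⟩ := h2
      subst h3
      rcases i with _ | i
      · exact absurd rfl h2
      · exact ⟨i, h1, rfl⟩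
    · rintro ⟨j, hj, h⟩
      cases h
      exact ⟨hj, by simp⟩
  rw [h, Finset.prod_image]
  intro i _ j _ hij
  simpa using hij

theorem apply_offspring_le {π : PMF ℕ} (hπ : TGWT.mean π ≠ ∞) {i : ℕ} (hi : i < height x) :
    π (offspring x (i + 1, [])) ≤ TGWT.mean π * TGWT.spineLaw π (spine x i) := by
  have hne := iterate_ne_of_lt_height hi
  have h2 := partialSum_le_of_recordMap_eq (recordMap_iterate_zero i) hne
  have h3 := partialSum_recordMap_nonneg (x := x) ((recordMap x)^[i] 0)
  rw [recordMap_iterate_zero] at h3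
  have h4 : offspring x (i + 1, []) = (spine x i).1 + 1 := by
    simp only [offspring, decode, spine]
    omega
  rw [h4]
  refine TGWT.le_mean_mul_spineLaw hπ (s := (spine x i).1) (u := (spine x i).2) ?_
  simp only [spine]
  omega

/-- The cylinder has mass (1-m) m^height times its spine and bush probabilities; each of the height
factors m pairs with one spine factor to dominate the offspring probability of one ancestor. -/
theorem le_measure_agreeSet {π : PMF ℕ} (hπ : TGWT.mean π < 1) (hx : DriftsDown x) :
    (1 - TGWT.mean π) * ∏ v ∈ hx.finite_recordComponentSet.toFinset, π (x (v - 1) + 1).toNat ≤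
      TGWT.dataLaw π hπ (agreeSet hx) := by
  have h1 : TGWT.dataLaw π hπ (agreeSet hx) =
      (1 - TGWT.mean π) * TGWT.mean π ^ height x *
        ((∏ i ∈ Finset.range (height x), TGWT.spineLaw π (spine x i)) *
          ∏ p ∈ bushCodes hx, π (offspring x p)) := by
    rw [TGWT.dataLaw, agreeSet, Measure.prod_prod, Measure.prod_prod,
      Measure.infinitePi_pi _ fun _ _ => measurableSet_singleton _,
      Measure.infinitePi_pi _ fun _ _ => measurableSet_singleton _,
      PMF.toMeasure_apply_singleton _ _ (measurableSet_singleton _)]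
    congr 1
    congr 1
    · exact Finset.prod_congr rfl fun i _ =>
        PMF.toMeasure_apply_singleton _ _ (measurableSet_singleton _)
    · exact Finset.prod_congr rfl fun i _ =>
        PMF.toMeasure_apply_singleton _ _ (measurableSet_singleton _)
  have h2 : ∏ i ∈ Finset.range (height x), π (offspring x (i + 1, [])) ≤
      TGWT.mean π ^ height x * ∏ i ∈ Finset.range (height x), TGWT.spineLaw π (spine x i) := by
    refine (Finset.prod_le_prod' fun i hi =>
      apply_offspring_le hπ.ne_top (Finset.mem_range.mp hi)).trans (le_of_eq ?_)
    rw [Finset.prod_mul_distrib, Finset.prod_const, Finset.card_range]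
  rw [h1, prod_component_eq_prod_codes hx, prod_codes_eq hx fun p => π (offspring x p), mul_assoc]
  refine mul_le_mul_right ?_ _
  rw [← mul_assoc, mul_comm]
  exact mul_le_mul_left h2 _

end RecordCode

section Law

variable {ρ : Measure ℤ} [IsProbabilityMeasure ρ] {π : PMF ℕ}

/-- The component of `0` in the record graph of i.i.d. increments is a Typically rooted
Galton–Watson Tree. -/
theorem hasLaw_mk_rooted (hge : ∀ᵐ k ∂ρ, -1 ≤ k) (hint : Integrable (fun k : ℤ => (k : ℝ)) ρ)
    (hneg : ∫ k, (k : ℝ) ∂ρ < 0) (hπ : ∀ n : ℕ, ρ {k | k + 1 = n} = π n)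
    (hm : TGWT.mean π < 1) :
    HasLaw (fun x => FamilyTreeSpace.mk (RecordComponent.rooted x)) (TGWT.law π hm)
      (Measure.infinitePi fun _ : ℤ => ρ) := by
  have hQ := ae_driftsDown hge hint hneg
  let ι := {s : Finset (ℤ × ℤ) // (recordGraphFiber s).Nonempty}
  let y : ι → ℤ → ℤ := fun s => s.2.choose
  have hy : ∀ s : ι, y s ∈ recordGraphFiber s.1 := fun s => s.2.choose_spec
  have hg : ∀ s : ι, ∀ d ∈ RecordCode.agreeSet (hy s).1,
      FamilyTreeSpace.mk (TGWT.rooted d.1 d.2.1 d.2.2) =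
        FamilyTreeSpace.mk (RecordComponent.rooted (y s)) := fun s d hd =>
    (RecordCode.compatible_of_mem_agreeSet (hy s).1 hd).mk_rooted (hy s).1
  have hdisj : Pairwise (Function.onFun Disjoint
      fun s : ι => RecordCode.agreeSet (hy s).1) := by
    -- Common data would make the components of both representatives isomorphic, and by rigidity
    -- their record graphs would coincide.
    refine fun s t hst => Set.disjoint_left.mpr fun d hs ht => hst (Subtype.ext
      (Finset.coe_injective ?_))
    rw [← (hy s).2, ← (hy t).2]
    exact RecordComponent.recordGraph_eq_of_iso
      (Quotient.exact ((hg s d hs).symm.trans (hg t d ht)))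
  have hcover : ∀ᵐ x ∂(Measure.infinitePi fun _ : ℤ => ρ),
      x ∈ ⋃ s : ι, recordGraphFiber s.1 := by
    filter_upwards [hQ] with x hx
    obtain ⟨s, hs⟩ := Set.mem_iUnion.mp hx.mem_iUnion_recordGraphFiber
    exact Set.mem_iUnion.mpr ⟨⟨s, x, hs⟩, hs⟩
  obtain ⟨h1, -, h3⟩ := map_eq_map_of_measure_le (ν := TGWT.dataLaw π hm)
    (f := fun x => FamilyTreeSpace.mk (RecordComponent.rooted x))
    (g := fun d => FamilyTreeSpace.mk (TGWT.rooted d.1 d.2.1 d.2.2))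
    (A := fun s : ι => recordGraphFiber s.1) (E := fun s : ι => RecordCode.agreeSet (hy s).1)
    (c := fun s => FamilyTreeSpace.mk (RecordComponent.rooted (y s))) hcover
    (fun s => measurableSet_recordGraphFiber s.1)
    (fun s => RecordCode.measurableSet_agreeSet (hy s).1)
    (fun s t hst => pairwise_disjoint_recordGraphFiber (Subtype.coe_injective.ne hst))
    hdisj
    (fun s x hx => RecordComponent.mk_eq_of_recordGraph_eq (hx.2.trans (hy s).2.symm) _ _
      fun _ => rfl) hg
    (fun s => (measure_recordGraphFiber_le hQ hπ (hy s)).trans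
      (RecordCode.le_measure_agreeSet hm (hy s).1))
  exact ⟨h1, h3⟩

end Law

theorem theorem20230213191656 {Ω : Type*} [MeasurableSpace Ω] (P : Measure Ω)
    [IsProbabilityMeasure P] (X : ℤ → Ω → ℤ) (hX : IsSkipFreeIncrements X P)
    (hneg : ∫ ω, (X 0 ω : ℝ) ∂P < 0)
    (π : PMF ℕ) (hπ : ∀ n : ℕ, P {ω | X 0 ω + 1 = n} = π n) :
    ∃ hm : TGWT.mean π < 1,
      HasLaw (fun ω => FamilyTreeSpace.mk (RecordComponent.rooted fun n => X n ω))
        (TGWT.law π hm) P ∧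
      FamilyTreeSpace.IsUnimodular
        (P.map fun ω => FamilyTreeSpace.mk (RecordComponent.rooted fun n => X n ω)) ∧
      ∀ᵐ ω ∂P, Finite (RecordComponent fun n => X n ω) ∧
        (RecordComponent.tree fun n => X n ω).IsClassFF := by
  have hX0 := hX.measurable 0
  have hρ : IsProbabilityMeasure (P.map (X 0)) :=
    Measure.isProbabilityMeasure_map hX0.aemeasurable
  have hcast : Measurable fun k : ℤ => (k : ℝ) := measurable_from_top
  have hXm : Measurable fun ω n => X n ω := measurable_pi_lambda _ hX.measurable
  -- All remaining claims concern the law of the whole sequence, so they are transferred from the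
  -- product measure on ℤ → ℤ.
  have hQ : P.map (fun ω n => X n ω) = Measure.infinitePi fun _ : ℤ => P.map (X 0) := by
    rw [hX.indep.map_fun_eq_infinitePi_map hX.measurable]
    congr 1
    ext1 n
    exact (hX.identDistrib n).map_eq
  have hge : ∀ᵐ k ∂(P.map (X 0)), -1 ≤ k :=
    (ae_map_iff hX0.aemeasurable (measurableSet_Ici (a := (-1 : ℤ)))).mpr (hX.ge_neg_one 0)
  have hint : Integrable (fun k : ℤ => (k : ℝ)) (P.map (X 0)) :=
    (integrable_map_measure hcast.aestronglyMeasurable hX0.aemeasurable).mpr hX.integrable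
  have hneg' : ∫ k, (k : ℝ) ∂(P.map (X 0)) < 0 := by
    rwa [integral_map hX0.aemeasurable hcast.aestronglyMeasurable]
  have hπ' : ∀ n : ℕ, P.map (X 0) {k | k + 1 = n} = π n := fun n => by
    rw [← hπ, Measure.map_apply hX0 (Set.to_countable _).measurableSet]
    rfl
  have hm := mean_lt_one hge hint hneg' hπ'
  have hdrift := ae_driftsDown hge hint hneg'
  have hlaw := hasLaw_mk_rooted hge hint hneg' hπ' hm
  have hmap : (P.map fun ω => FamilyTreeSpace.mk (RecordComponent.rooted fun n => X n ω)) =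
      (Measure.infinitePi fun _ : ℤ => P.map (X 0)).map
        fun x => FamilyTreeSpace.mk (RecordComponent.rooted x) := by
    rw [← hQ]
    exact (AEMeasurable.map_map_of_aemeasurable (by rw [hQ]; exact hlaw.aemeasurable)
      hXm.aemeasurable).symm
  refine ⟨hm, ⟨?_, ?_⟩, ?_, ?_⟩
  · have h : AEMeasurable (fun x => FamilyTreeSpace.mk (RecordComponent.rooted x))
        (P.map fun ω n => X n ω) := by
      rw [hQ]
      exact hlaw.aemeasurable
    exact h.comp_measurable hXm
  · rw [hmap, hlaw.map_eq]
  · rw [hmap]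
    exact FamilyTreeSpace.isUnimodular_map_rooted hdrift fun k => map_shiftSeq_infinitePi _ k
  · rw [← hQ] at hdrift
    filter_upwards [ae_of_ae_map hXm.aemeasurable hdrift] with ω hω
    have hfin : Finite (RecordComponent fun n => X n ω) := hω.finite_recordComponentSet
    exact ⟨hfin, hfin, fun u => Set.toFinite _⟩
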